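/- Let $1\le \ell\le n$ be integers and let $\mathcal H=\{(i,j) : 1\le i<j,\ \ell+1\le j\le n\}$, $N=|\mathcal H|=\binom n2-\binom \ell2$, be the index set of the hyperplanes of the discriminantal arrangement $\mathcal A_{n,\ell}$ in $\mathbb C^{n-\ell}$ (namely $H_{i,j}=\{x_i=x_j\}$ for $i>\ell$ and $H_{i,j}=\{x_j=z_i\}$ for $i\le \ell$, where $z_1,\dots,z_\ell\in\mathbb C$ are distinct). **Orlik–Solomon complex.** Let $A=\mathcal E/\mathcal I$, where $\mathcal E$ is the exterior algebra over $\mathbb C$ on generators $e_{i,j}$, $(i,j)\in\mathcal H$, and $\mathcal I$ is the ideal generated, for $1\le i<j<k\le n$ with $k>\ell$, by $e_{i,j}e_{i,k}-e_{i,j}e_{j,k}+e_{i,k}e_{j,k}$ if $j\ge \ell+1$ and by $e_{i,k}e_{j,k}$ if $j\le \ell$. Let $a_{i,j}\in A$ be the image of $e_{i,j}$ and $A^q$ the image of $\mathcal E^q$. For $\lambda\in\mathbb C^N$ let $\mu^q(\lambda):A^q\to A^{q+1}$ be left multiplication by $\sum\lambda_{i,j}a_{i,j}$. For $J=\{j_1<\dots<j_q\}\subseteq[\ell+1,n]$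 and $I=(i_1,\dots,i_q)$ with $1\le i_p<j_p$, put $a_{I,J}=a_{i_1,j_1}\wedge\dots\wedge a_{i_q,j_q}\in A^q$. **The group.** Let $P_n$ be the pure braid group with its standard generators $\gamma_{i,j}$, $1\le i<j\le n$, and relations $\gamma_{r,s}^{-1}\gamma_{i,j}\gamma_{r,s}=z_i\gamma_{i,j}z_i^{-1}$ for $r<s<j$, $i<j$, where $z_i=\gamma_{r,j}\gamma_{s,j}$ if $i\in\{r,s\}$, $z_i=\gamma_{r,j}\gamma_{s,j}\gamma_{r,j}^{-1}\gamma_{s,j}^{-1}$ if $r<i<s$, and $z_i=1$ otherwise. Let $G=P_{n,\ell}=\ker(P_n\to P_\ell)$ be the kernel of the map that forgets the last $n-\ell$ strands, and $R=\mathbb ZG$. For $\ell<j\le n$ let $G_j$ be the free group on $\gamma_{1,j},\dots,\gamma_{j-1,j}$; the group $P_{j-1,\ell}$ acts on it (on the right) by the formula $\gamma_{r,s}(\gamma_{i,j})=z_i\gamma_{i,j}z_i^{-1}$. For $\gamma\in P_{j-1,\ell}$ let $\mathcal J(\gamma)=\left(\partial\gamma(\gamma_{i,j})/\partial\gamma_{k,j}\right)_{i,k}$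 be the Jacobian matrix of Fox derivatives, let $\rho_j(\gamma)=\gamma\cdot\mathcal J(\gamma)$, a $(j-1)\times(j-1)$ matrix over $R$, extend $\rho_j$ to $G$ through the map $G\to P_{j-1,\ell}$ that forgets the strands $j,\dots,n$, and extend it additively to $\tilde\rho_j$ on $R$, and to matrices over $R$ by replacing each entry $x$ by the block $\tilde\rho_j(x)$. **The complex of the group.** Let $C_q=\bigoplus_{|J|=q}C_q^J$, where $J\subseteq[\ell+1,n]$ and $C_q^J$ is the free left $R$-module with basis indexed by the $I$ as above. Matrices act on row vectors from the right. Put $\Delta_{\{j\}}=(\gamma_{1,j}-1,\dots,\gamma_{j-1,j}-1)^\top$ and, for $J=\{j_1<\dots<j_q\}$ with $q\ge2$, $\Delta_J=-\tilde\rho_{j_q}(\Delta_{J\setminus\{j_q\}}):C_q^J\to C_{q-1}^{J\setminus\{j_1\}}$. The map $\partial_q:C_q\to C_{q-1}$ has as component $C_q^J\to C_{q-1}^{J\setminus\{j_p\}}$ the direct sum of $(j_1-1)\cdots(j_{p-1}-1)$ copies of $\Delta_{\{j_p,\dots,j_q\}}$ (indexed by $(i_1,\dots,i_{p-1})$), and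 no other components. For $\mathbf t\in(\mathbb C^*)^N$ let $L_{\mathbf t}$ be $\mathbb C$ with the action of $G$ by $\gamma_{i,j}\mapsto t_{i,j}$, let $\mathbf C^q=\operatorname{Hom}_G(C_q,L_{\mathbf t})$, and let $\delta^q(\mathbf t):\mathbf C^q\to\mathbf C^{q+1}$, $\delta^q(\mathbf t)(u)(x)=(-1)^q u(\partial_{q+1}(x))$. In terms of the standard basis of $C_q$ the space $\mathbf C^q$ is a coordinate space that does not depend on $\mathbf t$, and $\delta^q$ and $\partial_{q+1}(\mathbf t)$ (the evaluation of the matrix of $\partial_{q+1}$ under $\gamma_{i,j}\mapsto t_{i,j}$) are matrix-valued functions on $(\mathbb C^*)^N$. For such a function $F$ and $\lambda\in\mathbb C^N$ put $F_*(\lambda)=\frac{d}{dx}\big|_{x=0}F(\dots,e^{x\lambda_{i,j}},\dots)$, its derivative at $\mathbf 1=(1,\dots,1)$. **Theorem.** For every $\mathbf t\in(\mathbb C^*)^N$, $(\mathbf C^\bullet,\delta^\bullet(\mathbf t))$ is a complex; the matrices $\delta^q(\mathbf t)$ and $\partial_{q+1}(\mathbf t)$ depend holomorphically on $\mathbf t$.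 The complex $(A^\bullet,\mu^\bullet(\lambda))$ is a linear approximation of $(\mathbf C^\bullet,\delta^\bullet(\mathbf t))$ in the following sense. For each $\lambda\in\mathbb C^N$, $(\mathbf C^\bullet,\delta^\bullet_*(\lambda))$ is a complex. For each $q$ there is a linear isomorphism $A^q\cong\mathbf C^q$, independent of $\lambda$, that sends each $a_{I,J}$ to the corresponding element of the basis of $\mathbf C^q$ dual to the standard basis of $C_q$; and under this identification, for all $q$ and all $\lambda\in\mathbb C^N$, $$\mu^q(\lambda)=\delta^q_*(\lambda),\qquad\text{and, for the matrices acting on row vectors,}\qquad \mu^q(\lambda)=(-1)^q\bigl[(\partial_{q+1})_*(\lambda)\bigr]^\top .$$ -/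

import Mathlib

set_option linter.unusedSimpArgs false
set_option linter.unusedTactic false
set_option linter.unusedVariables false

namespace Discr

noncomputable section

section Artin

variable {X : Type*} [LinearOrder X]

/-- For a family `g i = γ_{i,j}` (with `j` fixed) and `r < s`, the element `z_i` such that
`γ_{r,s}⁻¹ γ_{i,j} γ_{r,s} = z_i γ_{i,j} z_i⁻¹`: it is `γ_{r,j} γ_{s,j}` if `i = r` or `i = s`, the
commutator `[γ_{r,j}, γ_{s,j}] = γ_{r,j} γ_{s,j} γ_{r,j}⁻¹ γ_{s,j}⁻¹` if `r < i < s`, and `1` otherwise. -/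
def conjugator {G : Type*} [Group G] (g : X → G) (r s i : X) : G :=
  if i = r ∨ i = s then g r * g s else if r < i ∧ i < s then g r * g s * (g r)⁻¹ * (g s)⁻¹ else 1

/-- The Artin action of `γ_{r,s}` on the free group on `X`: `x_i ↦ z_i x_i z_i⁻¹`. -/
def artinHom (r s : X) : FreeGroup X →* FreeGroup X :=
  FreeGroup.lift fun i =>
    conjugator FreeGroup.of r s i * FreeGroup.of i * (conjugator FreeGroup.of r s i)⁻¹

/-- The inverse of the Artin action of `γ_{r,s}`. -/
def artinInv (r s : X) : FreeGroup X →* FreeGroup X :=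
  FreeGroup.lift fun i =>
    if i = r ∨ i = s then
      (FreeGroup.of r * FreeGroup.of s)⁻¹ * FreeGroup.of i * (FreeGroup.of r * FreeGroup.of s)
    else if r < i ∧ i < s then
      (FreeGroup.of s)⁻¹ * (FreeGroup.of r)⁻¹ * FreeGroup.of s * FreeGroup.of r * FreeGroup.of i *
        ((FreeGroup.of s)⁻¹ * (FreeGroup.of r)⁻¹ * FreeGroup.of s * FreeGroup.of r)⁻¹
    else FreeGroup.of i

theorem artinHom_of (r s i : X) : artinHom r s (FreeGroup.of i) =
    conjugator FreeGroup.of r s i * FreeGroup.of i * (conjugator FreeGroup.of r s i)⁻¹ := by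
  simp [artinHom]

theorem artinHom_left {r s : X} : artinHom r s (FreeGroup.of r) =
    FreeGroup.of r * FreeGroup.of s * FreeGroup.of r * (FreeGroup.of r * FreeGroup.of s)⁻¹ := by
  simp [artinHom_of, conjugator]
theorem artinHom_right {r s : X} : artinHom r s (FreeGroup.of s) =
    FreeGroup.of r * FreeGroup.of s * FreeGroup.of s * (FreeGroup.of r * FreeGroup.of s)⁻¹ := by
  simp [artinHom_of, conjugator]
theorem artinHom_mid {r s i : X} (h : r < i) (h' : i < s) : artinHom r s (FreeGroup.of i) =
    FreeGroup.of r * FreeGroup.of s * (FreeGroup.of r)⁻¹ * (FreeGroup.of s)⁻¹ * FreeGroup.of i *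
      (FreeGroup.of r * FreeGroup.of s * (FreeGroup.of r)⁻¹ * (FreeGroup.of s)⁻¹)⁻¹ := by
  simp [artinHom_of, conjugator, h.ne', h'.ne, h, h']
theorem artinHom_lt {r s i : X} (hrs : r < s) (h : i < r) :
    artinHom r s (FreeGroup.of i) = FreeGroup.of i := by
  simp [artinHom_of, conjugator, h.ne, (h.trans hrs).ne, h.not_gt]
theorem artinHom_gt {r s i : X} (hrs : r < s) (h : s < i) :
    artinHom r s (FreeGroup.of i) = FreeGroup.of i := by
  simp [artinHom_of, conjugator, h.ne', (hrs.trans h).ne', h.not_gt]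

theorem position_cases (r s m : X) : m < r ∨ m = r ∨ (r < m ∧ m < s) ∨ m = s ∨ s < m := by
  rcases lt_trichotomy m r with h | h | h
  · simp [h]
  · simp [h]
  · rcases lt_trichotomy m s with h' | h' | h' <;> simp [*]

theorem artinInv_comp {r s : X} (h : r < s) : (artinInv r s).comp (artinHom r s) = MonoidHom.id _ := by
  ext m
  rcases position_cases r s m with hm | rfl | ⟨h1,h2⟩ | rfl | hm
  · simp [artinHom_lt h hm, artinInv, hm.ne, (hm.trans h).ne, hm.not_gt]
  · simp [artinHom_left, artinInv]; try group
    
  · simp [artinHom_mid h1 h2, artinInv, h1.ne', h2.ne, h1, h2]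
    group
  · simp [artinHom_right, artinInv]; try group
    
  · simp [artinHom_gt h hm, artinInv, hm.ne', (h.trans hm).ne', hm.not_gt]

theorem artinHom_comp {r s : X} (h : r < s) : (artinHom r s).comp (artinInv r s) = MonoidHom.id _ := by
  ext m
  rcases position_cases r s m with hm | rfl | ⟨h1,h2⟩ | rfl | hm
  · simp [artinHom_lt h hm, artinInv, hm.ne, (hm.trans h).ne, hm.not_gt]
  · simp [artinHom_left, artinHom_right, artinInv]; try group
  · simp [artinHom_mid h1 h2, artinHom_left, artinHom_right, artinInv, h1.ne', h2.ne, h1, h2]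
    try group
  · simp [artinHom_left,artinHom_right, artinInv]; try group
  · simp [artinHom_gt h hm, artinInv, hm.ne', (h.trans hm).ne', hm.not_gt]

theorem cyc1 {r s k : X} (h : r < s) (h' : s < k) :
  ((artinHom r s).comp (artinHom s k)).comp (artinHom r k) =
  ((artinHom r k).comp (artinHom r s)).comp (artinHom s k) := by
  ext m
  rcases position_cases r s m with hm | rfl | ⟨h1,h2⟩ | rfl | hm
  · simp [artinHom_lt h hm, artinHom_lt (h.trans h') hm, artinHom_lt h' (hm.trans h)]
  · simp [artinHom_lt h' h, artinHom_left, artinHom_right, artinHom_mid h h', artinHom_gt h h']; try group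
  · simp [artinHom_mid h1 h2, artinHom_mid h1 (h2.trans h'), artinHom_lt h' h2,artinHom_lt h' h, artinHom_left, artinHom_right, artinHom_mid h h', artinHom_gt h h']; try group
  · simp [artinHom_lt h' h, artinHom_left, artinHom_right, artinHom_mid h h', artinHom_gt h h']; try group
  · rcases lt_trichotomy m k with hk | rfl | hk
    · simp [artinHom_mid hm hk, artinHom_mid (h.trans hm) hk, artinHom_gt h hm, artinHom_lt h' h, artinHom_left, artinHom_right, artinHom_mid h h', artinHom_gt h h']; try group
    · simp [artinHom_gt h hm, artinHom_lt h' h, artinHom_left, artinHom_right, artinHom_mid h h', artinHom_gt h h']; try group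
    · simp [artinHom_gt h hm, artinHom_gt h' hk, artinHom_gt (h.trans h') hk]

theorem cyc2 {r s k : X} (h : r < s) (h' : s < k) :
  ((artinHom r s).comp (artinHom s k)).comp (artinHom r k) =
  ((artinHom s k).comp (artinHom r k)).comp (artinHom r s) := by
  ext m
  rcases position_cases r s m with hm | rfl | ⟨h1,h2⟩ | rfl | hm
  · simp [artinHom_lt h hm, artinHom_lt (h.trans h') hm, artinHom_lt h' (hm.trans h)]
  · simp [artinHom_lt h' h, artinHom_left, artinHom_right, artinHom_mid h h', artinHom_gt h h']; try group
  · simp [artinHom_mid h1 h2, artinHom_mid h1 (h2.trans h'), artinHom_lt h' h2,artinHom_lt h' h, artinHom_left, artinHom_right, artinHom_mid h h', artinHom_gt h h']; try group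
  · simp [artinHom_lt h' h, artinHom_left, artinHom_right, artinHom_mid h h', artinHom_gt h h']; try group
  · rcases lt_trichotomy m k with hk | rfl | hk
    · simp [artinHom_mid hm hk, artinHom_mid (h.trans hm) hk, artinHom_gt h hm, artinHom_lt h' h, artinHom_left, artinHom_right, artinHom_mid h h', artinHom_gt h h']; try group
    · simp [artinHom_gt h hm, artinHom_lt h' h, artinHom_left, artinHom_right, artinHom_mid h h', artinHom_gt h h']; try group
    · simp [artinHom_gt h hm, artinHom_gt h' hk, artinHom_gt (h.trans h') hk]

theorem comm_lt {r s i k : X} (h : r < s) (h' : s < k) (hi : i < r) :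
    (artinHom r s).comp (artinHom i k) = (artinHom i k).comp (artinHom r s) := by
  have hrk := h.trans h'
  have his := hi.trans h
  have hik := hi.trans hrk
  ext m
  rcases position_cases r s m with hm | rfl | ⟨h1, h2⟩ | rfl | hm
  · rcases position_cases i k m with hn | rfl | ⟨h3, h4⟩ | rfl | hn
    all_goals simp [*, artinHom_lt, artinHom_gt, artinHom_mid, artinHom_left, artinHom_right]
  · simp [*, artinHom_lt, artinHom_gt, artinHom_mid, artinHom_left, artinHom_right]; try group
  · have h3 := hi.trans h1
    have h4 := h2.trans h'
    simp [*, artinHom_lt, artinHom_gt, artinHom_mid, artinHom_left, artinHom_right]; try group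
  · simp [*, artinHom_lt, artinHom_gt, artinHom_mid, artinHom_left, artinHom_right]; try group
  · have h3 := his.trans hm
    rcases lt_trichotomy m k with hn | rfl | hn
    all_goals simp [*, artinHom_lt, artinHom_gt, artinHom_mid, artinHom_left, artinHom_right]

theorem comm_gt {r s i k : X} (h : r < s) (h' : s < i) (hi : i < k) :
    (artinHom r s).comp (artinHom i k) = (artinHom i k).comp (artinHom r s) := by
  have hri := h.trans h'
  have hrk := hri.trans hi
  have hsk := h'.trans hi
  ext m
  rcases position_cases r s m with hm | rfl | ⟨h1, h2⟩ | rfl | hm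
  · have h3 := hm.trans hri
    simp [*, artinHom_lt, artinHom_gt, artinHom_mid, artinHom_left, artinHom_right]
  · simp [*, artinHom_lt, artinHom_gt, artinHom_mid, artinHom_left, artinHom_right]
  · have h3 := h2.trans h'
    simp [*, artinHom_lt, artinHom_gt, artinHom_mid, artinHom_left, artinHom_right]
  · simp [*, artinHom_lt, artinHom_gt, artinHom_mid, artinHom_left, artinHom_right]
  · rcases position_cases i k m with hn | rfl | ⟨h3, h4⟩ | rfl | hn
    all_goals simp [*, artinHom_lt, artinHom_gt, artinHom_mid, artinHom_left, artinHom_right]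

theorem artinInv_left {r s : X} : artinInv r s (FreeGroup.of r) =
    (FreeGroup.of r * FreeGroup.of s)⁻¹ * FreeGroup.of r * (FreeGroup.of r * FreeGroup.of s) := by
  simp [artinInv]
theorem artinInv_right {r s : X} : artinInv r s (FreeGroup.of s) =
    (FreeGroup.of r * FreeGroup.of s)⁻¹ * FreeGroup.of s * (FreeGroup.of r * FreeGroup.of s) := by
  simp [artinInv]
theorem artinInv_mid {r s i : X} (h : r < i) (h' : i < s) : artinInv r s (FreeGroup.of i) =
      (FreeGroup.of s)⁻¹ * (FreeGroup.of r)⁻¹ * FreeGroup.of s * FreeGroup.of r * FreeGroup.of i *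
        ((FreeGroup.of s)⁻¹ * (FreeGroup.of r)⁻¹ * FreeGroup.of s * FreeGroup.of r)⁻¹ := by
  simp [artinInv, h.ne', h'.ne, h, h']
theorem artinInv_lt {r s i : X} (hrs : r < s) (h : i < r) :
    artinInv r s (FreeGroup.of i) = FreeGroup.of i := by
  simp [artinInv, h.ne, (h.trans hrs).ne, h.not_gt]
theorem artinInv_gt {r s i : X} (hrs : r < s) (h : s < i) :
    artinInv r s (FreeGroup.of i) = FreeGroup.of i := by
  simp [artinInv, h.ne', (hrs.trans h).ne', h.not_gt]

theorem comm_mid {r s i k : X} (hri : r < i) (his : i < s) (hsk : s < k) :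
    (artinHom r s).comp (((artinHom s k).comp (artinHom i k)).comp (artinInv s k)) =
    (((artinHom s k).comp (artinHom i k)).comp (artinInv s k)).comp (artinHom r s) := by
  have hrs := hri.trans his
  have hrk := hrs.trans hsk
  have hik := his.trans hsk
  ext m
  rcases lt_trichotomy m s with hm | rfl | hm
  · rcases position_cases r i m with hn | rfl | ⟨h3, h4⟩ | rfl | hn
    · have := hn.trans hri
      simp [*, artinHom_lt, artinHom_gt, artinHom_mid, artinHom_left, artinHom_right, artinInv_lt, artinInv_gt, artinInv_mid, artinInv_left, artinInv_right]
    · simp [*, artinHom_lt, artinHom_gt, artinHom_mid, artinHom_left, artinHom_right, artinInv_lt, artinInv_gt, artinInv_mid, artinInv_left, artinInv_right]; try group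
    · simp [*, artinHom_lt, artinHom_gt, artinHom_mid, artinHom_left, artinHom_right, artinInv_lt, artinInv_gt, artinInv_mid, artinInv_left, artinInv_right]; try group
    · simp [*, artinHom_lt, artinHom_gt, artinHom_mid, artinHom_left, artinHom_right, artinInv_lt, artinInv_gt, artinInv_mid, artinInv_left, artinInv_right]; try group
    · have := hri.trans hn
      have := hm.trans hsk
      simp [*, artinHom_lt, artinHom_gt, artinHom_mid, artinHom_left, artinHom_right, artinInv_lt, artinInv_gt, artinInv_mid, artinInv_left, artinInv_right]; try group
  · simp [*, artinHom_lt, artinHom_gt, artinHom_mid, artinHom_left, artinHom_right, artinInv_lt, artinInv_gt, artinInv_mid, artinInv_left, artinInv_right]; try group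
  · have := hrs.trans hm
    have := his.trans hm
    rcases lt_trichotomy m k with hn | rfl | hn
    all_goals
      simp [*, artinHom_lt, artinHom_gt, artinHom_mid, artinHom_left, artinHom_right, artinInv_lt, artinInv_gt, artinInv_mid, artinInv_left, artinInv_right]
      try group

/-- The Artin action of `γ_{r,s}`, `r < s`, as an automorphism of the free group on `X`. -/
def artinAut (r s : X) (h : r < s) : MulAut (FreeGroup X) :=
  MonoidHom.toMulEquiv (artinHom r s) (artinInv r s) (artinInv_comp h) (artinHom_comp h)

theorem conj_of_cyclic {H : Type*} [Group H] {a b c : H} (h1 : a * b * c = c * a * b)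
    (h2 : a * b * c = b * c * a) :
    c⁻¹ * a * c = a * b * a * (a * b)⁻¹ ∧ c⁻¹ * b * c = a * b * b * (a * b)⁻¹ := by
  constructor
  · rw [eq_mul_inv_iff_mul_eq, mul_assoc c⁻¹, mul_assoc c⁻¹, inv_mul_eq_iff_eq_mul]
    calc a * c * (a * b) = a * (c * a * b) := by group
      _ = a * (b * c * a) := by rw [← h1, h2]
      _ = a * b * c * a := by group
      _ = c * (a * b * a) := by rw [h1]; group
  · rw [eq_mul_inv_iff_mul_eq, mul_assoc c⁻¹, mul_assoc c⁻¹, inv_mul_eq_iff_eq_mul]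
    calc b * c * (a * b) = b * c * a * b := by group
      _ = c * (a * b * b) := by rw [← h2, h1]; group

theorem artinAut_cyc {r s k : X} (hrs : r < s) (hsk : s < k) :
    artinAut r s hrs * artinAut s k hsk * artinAut r k (hrs.trans hsk) =
        artinAut s k hsk * artinAut r k (hrs.trans hsk) * artinAut r s hrs ∧
      artinAut r s hrs * artinAut s k hsk * artinAut r k (hrs.trans hsk) =
        artinAut r k (hrs.trans hsk) * artinAut r s hrs * artinAut s k hsk :=
  ⟨MulEquiv.ext fun x => DFunLike.congr_fun (cyc2 hrs hsk) x,
    MulEquiv.ext fun x => DFunLike.congr_fun (cyc1 hrs hsk) x⟩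

theorem artinAut_comm_mid {r s i k : X} (hri : r < i) (his : i < s) (hsk : s < k) :
    artinAut r s (hri.trans his) *
        (artinAut s k hsk * artinAut i k (his.trans hsk) * (artinAut s k hsk)⁻¹) =
      artinAut s k hsk * artinAut i k (his.trans hsk) * (artinAut s k hsk)⁻¹ *
        artinAut r s (hri.trans his) :=
  MulEquiv.ext fun x => DFunLike.congr_fun (comm_mid hri his hsk) x

/-- The automorphisms `artinAut`, multiplied as right automorphisms, satisfy the pure braid
relations. -/
theorem artinAut_relation {r s k i : X} (hrs : r < s) (hsk : s < k) (hik : i < k)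
    {c : (MulAut (FreeGroup X))ᵐᵒᵖ} {g : X → (MulAut (FreeGroup X))ᵐᵒᵖ}
    (hc : c = MulOpposite.op (artinAut r s hrs))
    (hg : ∀ a (h : a < k), g a = MulOpposite.op (artinAut a k h)) :
    c⁻¹ * g i * c = conjugator g r s i * g i * (conjugator g r s i)⁻¹ := by
  have hrk := hrs.trans hsk
  obtain ⟨e1, e2⟩ := artinAut_cyc hrs hsk
  have h1 : g r * g s * c = c * g r * g s := by
    rw [hg r hrk, hg s hsk, hc]
    simp only [← MulOpposite.op_mul, ← mul_assoc]
    rw [e1]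
  have h2 : g r * g s * c = g s * c * g r := by
    rw [hg r hrk, hg s hsk, hc]
    simp only [← MulOpposite.op_mul, ← mul_assoc]
    rw [e2]
  obtain ⟨c1, c2⟩ := conj_of_cyclic h1 h2
  rcases position_cases r s i with h | rfl | ⟨h, h'⟩ | rfl | h
  · have : g i * c = c * g i := by
      rw [hg i hik, hc]
      simp only [← MulOpposite.op_mul]
      congr 1
      exact MulEquiv.ext fun x => DFunLike.congr_fun (comm_lt hrs hsk h) x
    simp [conjugator, h.ne, (h.trans hrs).ne, h.not_gt, mul_assoc, this]
  · simpa [conjugator] using c1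
  · have : (g s)⁻¹ * g i * g s * c = c * ((g s)⁻¹ * g i * g s) := by
      rw [hg i hik, hg s hsk, hc]
      simp only [← MulOpposite.op_mul, ← MulOpposite.op_inv]
      congr 1
      have := artinAut_comm_mid h h' hsk
      simp only [mul_assoc] at this ⊢
      exact this
    have e : c⁻¹ * g i * c = (c⁻¹ * g s * c) * (c⁻¹ * ((g s)⁻¹ * g i * g s * c)) *
        (c⁻¹ * g s * c)⁻¹ := by group
    rw [e, this, c2]
    simp only [conjugator, h.ne', h'.ne, h, h', or_self, and_self, if_true, if_false]
    group
  · simpa [conjugator] using c2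
  · have : g i * c = c * g i := by
      rw [hg i hik, hc]
      simp only [← MulOpposite.op_mul]
      congr 1
      exact MulEquiv.ext fun x => DFunLike.congr_fun (comm_gt hrs h hik) x
    simp [conjugator, h.ne', (hrs.trans h).ne', h.not_gt, mul_assoc, this]

theorem map_conjugator {G H : Type*} [Group G] [Group H] (φ : G →* H) (g : X → G)
    (r s i : X) : φ (conjugator g r s i) = conjugator (fun a => φ (g a)) r s i := by
  unfold conjugator; split_ifs <;> simp

end Artin

theorem conjugator_comp {X Y G : Type*} [LinearOrder X] [LinearOrder Y] [Group G] {φ : X → Y}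
    (hφ : StrictMono φ) (g : Y → G) (r s i : X) :
    conjugator (fun a => g (φ a)) r s i = conjugator g (φ r) (φ s) (φ i) := by
  simp only [conjugator, hφ.injective.eq_iff, hφ.lt_iff_lt]

/-- The pairs `(i, j)` with `i < j`, which index the standard generators `γ_{i,j}` of the pure braid
group on `n` strands. Strands are numbered by `Fin n`, that is, from `0` to `n - 1`. -/
abbrev Pair (n : ℕ) : Type := {p : Fin n × Fin n // p.1 < p.2}

/-- The strands below `j`; they index the generators `γ_{i,j}`, `i < j`, of the free group `G_j`. -/
abbrev Below {n : ℕ} (j : Fin n) : Type := {i : Fin n // i < j}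

/-- The standard relations of the pure braid group:
`γ_{r,s}⁻¹ γ_{i,k} γ_{r,s} = z_i γ_{i,k} z_i⁻¹` for `r < s < k` and `i < k`. -/
def pureBraidRels (n : ℕ) : Set (FreeGroup (Pair n)) :=
  {w | ∃ (k : Fin n) (r s i : Below k) (h : r < s),
    let c : FreeGroup (Pair n) := FreeGroup.of ⟨(r.1, s.1), h⟩
    let g : Below k → FreeGroup (Pair n) := fun a => FreeGroup.of ⟨(a.1, k), a.2⟩
    w = c⁻¹ * g i * c * (conjugator g r s i * g i * (conjugator g r s i)⁻¹)⁻¹}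

/-- The pure braid group `P_n` on `n` strands, in its standard presentation. -/
abbrev PureBraid (n : ℕ) : Type := PresentedGroup (pureBraidRels n)

/-- The homomorphism out of `P_n` with prescribed values on the generators. -/
def PureBraid.lift {n : ℕ} {H : Type*} [Group H] (f : Pair n → H)
    (hf : ∀ (k : Fin n) (r s i : Below k) (h : r < s),
      let c : H := f ⟨(r.1, s.1), h⟩
      let g : Below k → H := fun a => f ⟨(a.1, k), a.2⟩
      c⁻¹ * g i * c = conjugator g r s i * g i * (conjugator g r s i)⁻¹) :
    PureBraid n →* H :=
  PresentedGroup.toGroup (f := f) (by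
    rintro w ⟨k, r, s, i, h, rfl⟩
    have := hf k r s i h
    simp only [map_mul, map_inv, map_conjugator, FreeGroup.lift_apply_of] at this ⊢
    rw [this, mul_inv_cancel])

theorem PureBraid.lift_of {n : ℕ} {H : Type*} [Group H] (f : Pair n → H) (hf) (p : Pair n) :
    PureBraid.lift f hf (PresentedGroup.of p) = f p :=
  PresentedGroup.toGroup.of _

/-- The homomorphism `P_n → P_ℓ` which forgets the last `n - ℓ` strands. -/
def forget (n ℓ : ℕ) : PureBraid n →* PureBraid ℓ :=
  PureBraid.lift
    (fun p => if h : (p.1.2 : ℕ) < ℓ then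
      PresentedGroup.of ⟨(⟨p.1.1, lt_trans p.2 h⟩, ⟨p.1.2, h⟩), p.2⟩ else 1)
    (by
      intro k r s i h c g
      by_cases hk : (k : ℕ) < ℓ
      · have hb : ∀ a : Below k, (a.1 : ℕ) < ℓ := fun a => lt_trans a.2 hk
        have key := PresentedGroup.one_of_mem (rels := pureBraidRels ℓ)
          ⟨⟨k, hk⟩, ⟨⟨r.1, hb r⟩, r.2⟩, ⟨⟨s.1, hb s⟩, s.2⟩, ⟨⟨i.1, hb i⟩, i.2⟩, h, rfl⟩
        simp only [map_mul, map_inv, map_conjugator, mul_inv_eq_one] at key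
        have hc : c = PresentedGroup.of ⟨(⟨r.1, hb r⟩, ⟨s.1, hb s⟩), h⟩ := dif_pos (hb s)
        have hg : ∀ a, g a = PresentedGroup.of ⟨(⟨a.1, hb a⟩, ⟨k, hk⟩), a.2⟩ := fun a => dif_pos hk
        have hφ : StrictMono (fun a : Below k => (⟨⟨a.1, hb a⟩, a.2⟩ : Below (⟨k, hk⟩ : Fin ℓ))) :=
          fun a b hab => hab
        rw [← conjugator_comp hφ] at key
        rw [funext hg, hc]
        exact key
      · have hg : ∀ a, g a = 1 := fun a => dif_neg hk
        simp [conjugator, hg])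

/-- The homomorphism of `P_n` which forgets the strands `≥ j`: `γ_{p,q} ↦ γ_{p,q}` if `q < j`, and
`γ_{p,q} ↦ 1` if `q ≥ j`. -/
def retract {n : ℕ} (j : Fin n) : PureBraid n →* PureBraid n :=
  PureBraid.lift (fun p => if p.1.2 < j then PresentedGroup.of p else 1)
    (by
      intro k r s i h c g
      by_cases hk : k < j
      · have key := PresentedGroup.one_of_mem (rels := pureBraidRels n) ⟨k, r, s, i, h, rfl⟩
        simp only [map_mul, map_inv, map_conjugator, mul_inv_eq_one] at key
        have hc : c = PresentedGroup.of ⟨(r.1, s.1), h⟩ := if_pos (s.2.trans hk)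
        have hg : ∀ a, g a = PresentedGroup.of ⟨(a.1, k), a.2⟩ := fun a => if_pos hk
        simp only [conjugator, hc, hg] at key ⊢
        exact key
      · have hg : ∀ a, g a = 1 := fun a => if_neg hk
        simp [conjugator, hg])

/-- The Artin representation of `P_n` by right automorphisms of the free group `G_j`
(whence the opposite group): `γ_{r,s}` acts by the Artin automorphism if `s < j`, and trivially if
`s ≥ j`. -/
def artin {n : ℕ} (j : Fin n) : PureBraid n →* (MulAut (FreeGroup (Below j)))ᵐᵒᵖ :=
  PureBraid.lift
    (fun p => if h : p.1.2 < j then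
      MulOpposite.op (artinAut (⟨p.1.1, p.2.trans h⟩ : Below j) ⟨p.1.2, h⟩ p.2) else 1)
    (by
      intro k r s i h c g
      by_cases hk : k < j
      · let k' : Below j := ⟨k, hk⟩
        have key := artinAut_relation (r := (⟨r.1, r.2.trans hk⟩ : Below j))
          (s := ⟨s.1, s.2.trans hk⟩) (k := k') (i := ⟨i.1, i.2.trans hk⟩) h s.2 i.2 (c := c)
          (g := fun a => if h : a < k' then MulOpposite.op (artinAut a k' h) else 1)
          (dif_pos (s.2.trans hk)) (fun a h => dif_pos h)
        have hφ : StrictMono (fun a : Below k => (⟨a.1, a.2.trans hk⟩ : Below j)) :=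
          fun a b hab => hab
        rw [← conjugator_comp hφ] at key
        have hg : g = fun a : Below k => if h : (⟨a.1, a.2.trans hk⟩ : Below j) < k' then
            MulOpposite.op (artinAut (⟨a.1, a.2.trans hk⟩ : Below j) k' h) else 1 := by
          funext a
          have h1 : (⟨a.1, a.2.trans hk⟩ : Below j) < k' := a.2
          rw [dif_pos h1]
          exact dif_pos hk
        rw [hg]
        exact key
      · have hg : ∀ a, g a = 1 := fun a => dif_neg hk
        simp [conjugator, hg])

/-- The group `P_{n,ℓ} = ker (P_n → P_ℓ)`. -/
abbrev DiscrGroup (n ℓ : ℕ) : Subgroup (PureBraid n) := (forget n ℓ).ker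

/-- The index set of the hyperplanes `H_{i,j}`, `i < j`, `ℓ < j` (in the numbering from `1`), of the
discriminantal arrangement. Strands being numbered from `0` here, the condition on `j` reads
`ℓ ≤ j`. -/
abbrev Hyp (n ℓ : ℕ) : Type := {p : Fin n × Fin n // p.1 < p.2 ∧ ℓ ≤ (p.2 : ℕ)}

theorem forget_of {n ℓ : ℕ} (p : Pair n) : forget n ℓ (PresentedGroup.of p) =
    if h : (p.1.2 : ℕ) < ℓ then
      PresentedGroup.of ⟨(⟨p.1.1, lt_trans p.2 h⟩, ⟨p.1.2, h⟩), p.2⟩ else 1 :=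
  PureBraid.lift_of _ _ _

theorem retract_of {n : ℕ} (j : Fin n) (p : Pair n) : retract j (PresentedGroup.of p) =
    if p.1.2 < j then PresentedGroup.of p else 1 :=
  PureBraid.lift_of _ _ _

theorem artin_of {n : ℕ} (j : Fin n) (p : Pair n) : artin j (PresentedGroup.of p) =
    if h : p.1.2 < j then
      MulOpposite.op (artinAut (⟨p.1.1, p.2.trans h⟩ : Below j) ⟨p.1.2, h⟩ p.2) else 1 :=
  PureBraid.lift_of _ _ _

/-- The generator `γ_{i,j}` of `P_{n,ℓ}`. -/
def gen {n ℓ : ℕ} (h : Hyp n ℓ) : DiscrGroup n ℓ :=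
  ⟨PresentedGroup.of ⟨h.1, h.2.1⟩, by
    rw [MonoidHom.mem_ker, forget_of, dif_neg (not_lt.mpr h.2.2)]⟩

theorem forget_retract {n ℓ : ℕ} (j : Fin n) (hj : ℓ ≤ (j : ℕ)) :
    (forget n ℓ).comp (retract j) = forget n ℓ := by
  refine PresentedGroup.ext fun p => ?_
  rw [MonoidHom.comp_apply, retract_of]
  split_ifs with h
  · rfl
  · rw [map_one, forget_of, dif_neg]
    exact fun h' => h (Fin.lt_def.mpr (lt_of_lt_of_le h' hj))

/-- The homomorphism `retract j` on the subgroup `P_{n,ℓ}`, for a strand `j` that is not among the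
first `ℓ` ones; its image is the subgroup `P_{j-1,ℓ}` (in the numbering from `1`). -/
def retractDiscr {n ℓ : ℕ} (j : Fin n) (hj : ℓ ≤ (j : ℕ)) : DiscrGroup n ℓ →* DiscrGroup n ℓ :=
  ((retract j).comp (DiscrGroup n ℓ).subtype).codRestrict (DiscrGroup n ℓ) fun x => by
    rw [MonoidHom.mem_ker, MonoidHom.comp_apply, ← MonoidHom.comp_apply, forget_retract j hj]
    exact x.2

/-- The character of `P_n` with `γ_{i,j} ↦ t_{i,j}` if `j` is not among the first `ℓ` strands, and
`γ_{i,j} ↦ 1` otherwise. -/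
def ambientCharacter {n ℓ : ℕ} (t : Hyp n ℓ → ℂˣ) : PureBraid n →* ℂˣ :=
  PureBraid.lift (fun p : Pair n => if h : ℓ ≤ (p.1.2 : ℕ) then t ⟨p.1, p.2, h⟩ else 1)
    (by intro k r s i h c g; rw [inv_mul_cancel_comm, mul_inv_cancel_comm])

/-- The rank one representation `ν_t : P_{n,ℓ} → ℂˣ`, `γ_{i,j} ↦ t_{i,j}`. -/
def character {n ℓ : ℕ} (t : Hyp n ℓ → ℂˣ) : DiscrGroup n ℓ →* ℂˣ :=
  (ambientCharacter t).comp (DiscrGroup n ℓ).subtype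

theorem ambientCharacter_of {n ℓ : ℕ} (t : Hyp n ℓ → ℂˣ) (p : Pair n) :
    ambientCharacter t (PresentedGroup.of p) =
      if h : ℓ ≤ (p.1.2 : ℕ) then t ⟨p.1, p.2, h⟩ else 1 :=
  PureBraid.lift_of _ _ _

theorem character_gen {n ℓ : ℕ} (t : Hyp n ℓ → ℂˣ) (h : Hyp n ℓ) : character t (gen h) = t h :=
  (ambientCharacter_of t ⟨h.1, h.2.1⟩).trans (dif_pos h.2.2)

/-- The Fox derivative with respect to `x_k` of a word in the letters `x_i` and `x_i⁻¹`: it sends `x_k`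
to `1`, the other letters `x_i` to `0`, and `v w` to `∂v + v ∂w`. -/
def foxWord {X : Type*} [DecidableEq X] (k : X) :
    List (X × Bool) → MonoidAlgebra ℤ (FreeGroup X)
  | [] => 0
  | (i, true) :: w => (if i = k then 1 else 0) + MonoidAlgebra.single (FreeGroup.of i) 1 * foxWord k w
  | (i, false) :: w =>
      MonoidAlgebra.single (FreeGroup.of i)⁻¹ 1 * (foxWord k w - if i = k then 1 else 0)

theorem foxWord_append {X : Type*} [DecidableEq X] (k : X) (v w : List (X × Bool)) :
    foxWord k (v ++ w) = foxWord k v + MonoidAlgebra.single (FreeGroup.mk v) 1 * foxWord k w := by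
  induction v with
  | nil => simp [foxWord, ← FreeGroup.one_eq_mk, ← MonoidAlgebra.one_def]
  | cons a v ih =>
    obtain ⟨i, b⟩ := a
    have e : FreeGroup.mk ((i, b) :: v) = FreeGroup.mk [(i, b)] * FreeGroup.mk v := by
      simp [FreeGroup.mul_mk]
    have e2 : MonoidAlgebra.single (FreeGroup.mk ((i, b) :: v)) (1 : ℤ) =
        MonoidAlgebra.single (FreeGroup.mk [(i, b)]) 1 * MonoidAlgebra.single (FreeGroup.mk v) 1 := by
      rw [e, MonoidAlgebra.single_mul_single, one_mul]
    cases b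
    · have e3 : FreeGroup.mk [(i, false)] = (FreeGroup.of i)⁻¹ := rfl
      rw [List.cons_append, foxWord, foxWord, ih, e2, e3]
      simp only [mul_add, mul_sub, mul_assoc]
      abel
    · have e3 : FreeGroup.mk [(i, true)] = FreeGroup.of i := rfl
      rw [List.cons_append, foxWord, foxWord, ih, e2, e3]
      simp only [mul_add, mul_assoc]
      abel

/-- The Fox derivative `∂g/∂x_k` in the integral group ring of the free group. -/
def fox {X : Type*} [DecidableEq X] (k : X) (g : FreeGroup X) : MonoidAlgebra ℤ (FreeGroup X) :=
  Quot.lift (foxWord k) (by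
    rintro _ _ @⟨v, w, i, b⟩
    rw [foxWord_append, foxWord_append]
    congr 2
    have e : MonoidAlgebra.single (FreeGroup.of i) (1 : ℤ) * MonoidAlgebra.single (FreeGroup.of i)⁻¹ 1 = 1 := by
      rw [MonoidAlgebra.single_mul_single, mul_inv_cancel, one_mul, MonoidAlgebra.one_def]
    have e' : MonoidAlgebra.single (FreeGroup.of i)⁻¹ (1 : ℤ) * MonoidAlgebra.single (FreeGroup.of i) 1 = 1 := by
      rw [MonoidAlgebra.single_mul_single, inv_mul_cancel, one_mul, MonoidAlgebra.one_def]
    cases b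
    · simp [foxWord, ← mul_assoc, e']
    · simp [foxWord, ← mul_assoc, e]) g

theorem fox_one {X : Type*} [DecidableEq X] (k : X) : fox k (1 : FreeGroup X) = 0 := rfl

theorem fox_of {X : Type*} [DecidableEq X] (k i : X) :
    fox k (FreeGroup.of i) = if i = k then 1 else 0 := by
  change foxWord k [(i, true)] = _
  simp [foxWord]

theorem fox_mul {X : Type*} [DecidableEq X] (k : X) (g h : FreeGroup X) :
    fox k (g * h) = fox k g + MonoidAlgebra.single g 1 * fox k h := by
  induction g using Quot.inductionOn with | _ v =>
  induction h using Quot.inductionOn with | _ w =>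
  exact foxWord_append k v w

/-- The integral group ring `R = ℤ P_{n,ℓ}`. -/
abbrev GroupRing (n ℓ : ℕ) : Type := MonoidAlgebra ℤ (DiscrGroup n ℓ)

/-- The homomorphism `G_j → P_{n,ℓ}`, `x_i ↦ γ_{i,j}`. -/
def fibre {n ℓ : ℕ} (j : Fin n) (hj : ℓ ≤ (j : ℕ)) : FreeGroup (Below j) →* DiscrGroup n ℓ :=
  FreeGroup.lift fun i => gen ⟨(i.1, j), i.2, hj⟩

/-- The matrix of `ρ_j(γ)`, namely `γ · J(γ)`, where `J(γ) = (∂γ(x_i)/∂x_k)` is the Fox Jacobian of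
the automorphism of `G_j` given by `γ`; here an element `γ` is first sent to `P_{j-1,ℓ}`, so that
`ρ_j(γ_{p,q}) = 1` for `q ≥ j`. -/
def rho {n ℓ : ℕ} (j : Fin n) (hj : ℓ ≤ (j : ℕ)) (γ : DiscrGroup n ℓ) :
    Matrix (Below j) (Below j) (GroupRing n ℓ) :=
  Matrix.of fun i k => MonoidAlgebra.single (retractDiscr j hj γ) 1 *
    MonoidAlgebra.mapDomainRingHom ℤ (fibre j hj)
      (fox k ((artin j (γ : PureBraid n)).unop (FreeGroup.of i)))

/-- The additive extension of `ρ_j` to the group ring `R`. -/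
def rhoRing {n ℓ : ℕ} (j : Fin n) (hj : ℓ ≤ (j : ℕ)) :
    GroupRing n ℓ →+ Matrix (Below j) (Below j) (GroupRing n ℓ) :=
  MonoidAlgebra.liftNC (Int.castAddHom _) (rho j hj)

/-- The pairs `(I, J)` with `I = (i_1, …, i_q)`, `J = (j_1 < … < j_q)`, and `(i_p, j_p)` the index of
a hyperplane for each `p`. They index the standard basis of the free module `C_q = ⨁ C_q^J` and the
monomials `a_{I,J}`. -/
abbrev Idx (n ℓ q : ℕ) : Type := {h : Fin q → Hyp n ℓ // StrictMono fun p => (h p).1.2}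

/-- The `(r, c)` entry of the matrix of `ρ_j(x)`, for the row index `r = (i, j)` and the column
index `c = (k, j)`. -/
def rhoEntry {n ℓ : ℕ} (r c : Hyp n ℓ) (x : GroupRing n ℓ) : GroupRing n ℓ :=
  if h : c.1.2 = r.1.2 then
    rhoRing r.1.2 r.2.2 x ⟨r.1.1, r.2.1⟩ ⟨c.1.1, h ▸ c.2.1⟩
  else 0

/-- The entries of the matrix of `Δ_J`, for `J = (j_1 < … < j_{m+1})`, with rows indexed by
`(i_1, …, i_{m+1})` and columns by `(k_2, …, k_{m+1})`: the entries of `Δ_{{j}}` are `γ_{i,j} - 1`,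
and `Δ_J = -ρ_{j_{m+1}}(Δ_{J'})`, where `J'` is `J` without its last element and `ρ_j` of a matrix
is obtained by replacing each entry `x` by the matrix `ρ_j(x)`. -/
def blockEntry {n ℓ : ℕ} : (m : ℕ) → (Fin (m + 1) → Hyp n ℓ) → (Fin m → Hyp n ℓ) → GroupRing n ℓ
  | 0, r, _ => MonoidAlgebra.single (gen (r 0)) 1 - 1
  | m + 1, r, c => -rhoEntry (r (Fin.last (m + 1))) (c (Fin.last m))
      (blockEntry m (fun s => r s.castSucc) (fun s => c s.castSucc))

/-- The matrix of `∂_{q+1} : C_{q+1} → C_q`. Its block from `C^J` to `C^{J ∖ {j_p}}` is the direct sum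
of `(j_1 - 1) ⋯ (j_{p-1} - 1)` copies of `Δ_{{j_p, …, j_{q+1}}}` (all in the numbering from `1`; in
the code, `p` starts from `0`), and the other blocks are zero. -/
def boundaryMatrix (n ℓ q : ℕ) : Matrix (Idx n ℓ (q + 1)) (Idx n ℓ q) (GroupRing n ℓ) :=
  Matrix.of fun r c => ∑ p : Fin (q + 1),
    if (∀ s : Fin q, (c.1 s).1.2 = (r.1 (p.succAbove s)).1.2) ∧
        (∀ s : Fin q, s.castSucc < p → c.1 s = r.1 s.castSucc) then
      blockEntry (q - p) (fun s => r.1 ⟨p + s, by omega⟩) (fun s => c.1 ⟨p + s, by omega⟩)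
    else 0

/-- The free module `C_q` over the group ring `R`. -/
abbrev Chain (n ℓ q : ℕ) : Type := Idx n ℓ q → GroupRing n ℓ

/-- The boundary map `∂_{q+1} : C_{q+1} → C_q`; elements of free left modules are row vectors, on
which matrices act from the right. -/
def boundary (n ℓ q : ℕ) : Chain n ℓ (q + 1) →ₗ[GroupRing n ℓ] Chain n ℓ q :=
  (boundaryMatrix n ℓ q).toLinearMapRight'

/-- The extension of `ν_t` to a ring homomorphism `R → ℂ`. -/
def evalRing {n ℓ : ℕ} (t : Hyp n ℓ → ℂˣ) : GroupRing n ℓ →+* ℂ :=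
  MonoidAlgebra.liftNCRingHom (Int.castRingHom ℂ) ((Units.coeHom ℂ).comp (character t))
    fun _ _ => Commute.all _ _

/-- The `P_{n,ℓ}`-module `L_t`: the vector space `ℂ`, on which the group acts through `ν_t`. -/
def LocalSys {n ℓ : ℕ} (_t : Hyp n ℓ → ℂˣ) : Type := ℂ

instance {n ℓ : ℕ} (t : Hyp n ℓ → ℂˣ) : AddCommGroup (LocalSys t) :=
  inferInstanceAs (AddCommGroup ℂ)

instance {n ℓ : ℕ} (t : Hyp n ℓ → ℂˣ) : Module ℂ (LocalSys t) :=
  inferInstanceAs (Module ℂ ℂ)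

instance {n ℓ : ℕ} (t : Hyp n ℓ → ℂˣ) : Module (GroupRing n ℓ) (LocalSys t) :=
  Module.compHom ℂ (evalRing t)

instance {n ℓ : ℕ} (t : Hyp n ℓ → ℂˣ) : SMulCommClass (GroupRing n ℓ) ℂ (LocalSys t) :=
  ⟨fun r z w => mul_left_comm (evalRing t r) z w⟩

/-- The complex vector space `C^q = Hom_G(C_q, L_t)` of `R`-linear maps. -/
abbrev Cochain {n ℓ : ℕ} (q : ℕ) (t : Hyp n ℓ → ℂˣ) : Type :=
  Chain n ℓ q →ₗ[GroupRing n ℓ] LocalSys t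

/-- The coboundary map `δ^q(t) : C^q → C^{q+1}`, `δ^q(t)(u)(x) = (-1)^q u(∂_{q+1} x)`. -/
def coboundary {n ℓ : ℕ} (q : ℕ) (t : Hyp n ℓ → ℂˣ) : Cochain q t →ₗ[ℂ] Cochain (q + 1) t where
  toFun u := (-1 : ℂ) ^ q • u.comp (boundary n ℓ q)
  map_add' u v := by rw [LinearMap.add_comp, smul_add]
  map_smul' z u := by rw [LinearMap.smul_comp, smul_comm]; rfl

/-- The underlying complex vector space of `L_t` is `ℂ`. -/
def LocalSys.toComplex {n ℓ : ℕ} (t : Hyp n ℓ → ℂˣ) : LocalSys t ≃ₗ[ℂ] ℂ :=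
  LinearEquiv.refl ℂ ℂ

theorem LocalSys.toComplex_smul {n ℓ : ℕ} (t : Hyp n ℓ → ℂˣ) (x : GroupRing n ℓ) (w : LocalSys t) :
    LocalSys.toComplex t (x • w) = evalRing t x * LocalSys.toComplex t w := rfl

/-- The coordinates of an element of `C^q = Hom_G(C_q, L_t)`: its values on the standard basis of
`C_q`. They identify the spaces `C^q` for all `t` with one space. -/
def coord {n ℓ : ℕ} (q : ℕ) (t : Hyp n ℓ → ℂˣ) : Cochain q t ≃ₗ[ℂ] (Idx n ℓ q → ℂ) :=
  ((Pi.basisFun (GroupRing n ℓ) (Idx n ℓ q)).constr ℂ).symm ≪≫ₗ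
    LinearEquiv.piCongrRight fun _ => LocalSys.toComplex t

theorem coord_apply {n ℓ : ℕ} (q : ℕ) (t : Hyp n ℓ → ℂˣ) (u : Cochain q t) (b : Idx n ℓ q) :
    coord q t u b = LocalSys.toComplex t (u (Pi.single b 1)) := by
  change LocalSys.toComplex t (u (Pi.basisFun (GroupRing n ℓ) (Idx n ℓ q) b)) = _
  rw [Pi.basisFun_apply]

/-- The generators `e_{i,j}` of the exterior algebra `E`. -/
def extGen {n ℓ : ℕ} (h : Hyp n ℓ) : ExteriorAlgebra ℂ (Hyp n ℓ → ℂ) :=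
  ExteriorAlgebra.ι ℂ (Pi.single h 1)

/-- The generators of the ideal `I` of the exterior algebra, each one set equal to `0`. -/
inductive OSRel (n ℓ : ℕ) :
    ExteriorAlgebra ℂ (Hyp n ℓ → ℂ) → ExteriorAlgebra ℂ (Hyp n ℓ → ℂ) → Prop
  | triple (i j k : Fin n) (hij : i < j) (hjk : j < k) (hj : ℓ ≤ (j : ℕ)) (hk : ℓ ≤ (k : ℕ)) :
      OSRel n ℓ
        (extGen ⟨(i, j), hij, hj⟩ * extGen ⟨(i, k), hij.trans hjk, hk⟩ -
          extGen ⟨(i, j), hij, hj⟩ * extGen ⟨(j, k), hjk, hk⟩ +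
          extGen ⟨(i, k), hij.trans hjk, hk⟩ * extGen ⟨(j, k), hjk, hk⟩) 0
  | parallel (i j k : Fin n) (hij : i < j) (hjk : j < k) (hj : (j : ℕ) < ℓ) (hk : ℓ ≤ (k : ℕ)) :
      OSRel n ℓ (extGen ⟨(i, k), hij.trans hjk, hk⟩ * extGen ⟨(j, k), hjk, hk⟩) 0

/-- The Orlik–Solomon algebra `A = E / I` of the discriminantal arrangement. -/
abbrev OSAlgebra (n ℓ : ℕ) : Type := RingQuot (OSRel n ℓ)

/-- The quotient map `E → A`. -/
def osMk (n ℓ : ℕ) : ExteriorAlgebra ℂ (Hyp n ℓ → ℂ) →ₐ[ℂ] OSAlgebra n ℓ :=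
  RingQuot.mkAlgHom ℂ (OSRel n ℓ)

/-- The degree `q` part `A^q`, the image of the degree `q` part of the exterior algebra. -/
def OSDeg (n ℓ q : ℕ) : Submodule ℂ (OSAlgebra n ℓ) :=
  (⋀[ℂ]^q (Hyp n ℓ → ℂ)).map (osMk n ℓ).toLinearMap

/-- The generators `a_{i,j}` of `A`. -/
def osGen {n ℓ : ℕ} (h : Hyp n ℓ) : OSAlgebra n ℓ := osMk n ℓ (extGen h)

/-- The element `ω_λ = ∑ λ_{i,j} a_{i,j}`. -/
def omega {n ℓ : ℕ} (lam : Hyp n ℓ → ℂ) : OSAlgebra n ℓ := ∑ h, lam h • osGen h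

theorem omega_mul_mem {n ℓ q : ℕ} (lam : Hyp n ℓ → ℂ) (x : OSAlgebra n ℓ) (hx : x ∈ OSDeg n ℓ q) :
    omega lam * x ∈ OSDeg n ℓ (q + 1) := by
  obtain ⟨y, hy, rfl⟩ := hx
  refine ⟨(∑ h, lam h • extGen h) * y, ?_, by simp [omega, osGen]⟩
  have : (∑ h, lam h • extGen h) ∈ LinearMap.range (ExteriorAlgebra.ι ℂ (M := Hyp n ℓ → ℂ)) :=
    Submodule.sum_mem _ fun h _ => Submodule.smul_mem _ _ ⟨_, rfl⟩
  change _ ∈ LinearMap.range (ExteriorAlgebra.ι ℂ (M := Hyp n ℓ → ℂ)) ^ (q + 1)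
  rw [pow_succ']
  exact Submodule.mul_mem_mul this hy

/-- The differential `μ^q(λ) : A^q → A^{q+1}`, left multiplication by `ω_λ`. -/
def mu {n ℓ : ℕ} (q : ℕ) (lam : Hyp n ℓ → ℂ) : OSDeg n ℓ q →ₗ[ℂ] OSDeg n ℓ (q + 1) :=
  (LinearMap.mulLeft ℂ (omega lam)).restrict (omega_mul_mem lam)

/-- The monomial `a_{I,J} = a_{i_1,j_1} ∧ … ∧ a_{i_q,j_q}`. -/
def monomial {n ℓ q : ℕ} (b : Idx n ℓ q) : OSDeg n ℓ q :=
  ⟨(List.ofFn fun p => osGen (b.1 p)).prod,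
    ExteriorAlgebra.ιMulti ℂ q fun p => Pi.single (b.1 p) 1,
    ExteriorAlgebra.ιMulti_range ℂ q ⟨_, rfl⟩, by
      simp [ExteriorAlgebra.ιMulti_apply, map_list_prod, List.map_ofFn, osGen, extGen,
        Function.comp_def]⟩

/-- The matrix of `δ^q(t)` in the coordinates `coord` (acting on column vectors). -/
def coboundaryMatrix {n ℓ : ℕ} (q : ℕ) (t : Hyp n ℓ → ℂˣ) :
    Matrix (Idx n ℓ (q + 1)) (Idx n ℓ q) ℂ :=
  LinearMap.toMatrix'
    ((coord (q + 1) t).toLinearMap ∘ₗ coboundary q t ∘ₗ (coord q t).symm.toLinearMap)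

/-- The matrix of `∂_{q+1}(t)`, the evaluation of the matrix of `∂_{q+1}` at `t` (acting on row
vectors from the right). -/
def boundaryMatrixAt {n ℓ : ℕ} (q : ℕ) (t : Hyp n ℓ → ℂˣ) :
    Matrix (Idx n ℓ (q + 1)) (Idx n ℓ q) ℂ :=
  (boundaryMatrix n ℓ q).map (evalRing t)

/-- The point `(…, exp v_{i,j}, …)` of the complex torus. -/
def expPoint {n ℓ : ℕ} (v : Hyp n ℓ → ℂ) : Hyp n ℓ → ℂˣ :=
  fun h => Units.mk0 (Complex.exp (v h)) (Complex.exp_ne_zero _)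

/-- The derivative at `1`, in the direction of `λ`, of a matrix-valued function `F` on the complex
torus: the entries are the derivatives at `x = 0` of the entries of `F(…, exp (x λ_{i,j}), …)`. -/
def derivAtOne {n ℓ : ℕ} {α β : Type*} (F : (Hyp n ℓ → ℂˣ) → Matrix α β ℂ) (lam : Hyp n ℓ → ℂ) :
    Matrix α β ℂ :=
  Matrix.of fun a b => deriv (fun x : ℂ => F (expPoint (x • lam)) a b) 0

end

end Discr

open Discr

/-!
Both complexes are built one strand at a time. The proof describes each of them by a recursion over
the last strand, and the recursions turn out to agree to first order.

The complex. Braids act on the free group `G_j` by conjugation (`fibre_artin`); with the chain rule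
for Fox derivatives this makes `ρ_j` multiplicative (`rho_mul`, `rhoRing_mul`), and the fundamental
formula of Fox calculus gives `ρ_j(x) Δ_{{j}} = Δ_{{j}} x'` (`sum_rhoRing_mul`). The boundary matrix on
`C^J`, for `J` with last element `j`, consists of `-ρ_j` of the boundary matrix on `C^{J ∖ {j}}` and of
copies of `Δ_{{j}}` (`boundaryMatrix_succ`), and `∂ ∂ = 0` follows by induction (`boundaryMatrix_mul`),
already over the group ring `R`. Its entries, evaluated at `(…, exp v_{i,j}, …)`, are integral
combinations of exponentials of linear forms, hence holomorphic.

The linearization. At the trivial character the matrices `ρ_j(γ)` are unipotent, so that their first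
order part is additive in `γ`, and therefore is determined by the generators (`derivOne_rhoRing`),
where it is computed from the Artin action (`derivRho_gen`).

The Orlik–Solomon algebra. For `i, k < j` its relations say
`a_{i,j} a_{k,j} = a_{i,k} (a_{k,j} - a_{i,j})`, where `a_{i,k} = 0` if there is no such generator. So
left multiplication by a generator can be written as a rule on monomials, by recursion on the last
factor. On the free vector space on all words, ordered or not, these rules define operators `lmul`
which satisfy the relations of the algebra (`Word.relations`). So the algebra acts on words, and acting
on the empty word expands an element in ordered monomials; multiplying out is inverse to this
(`toOS_expand`), so the monomials `a_{I,J}` form a basis of `A^q` (`osCoord_bijective`).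

The recursion for `lmul` is the one that the linearized boundary matrices satisfy
(`lmulSum_toList`). That the linearized complex is a complex then follows from `ω_λ ω_λ = 0`.
-/

namespace Discr

/-! ### Fox calculus -/

section FoxCalculus

variable {X Y : Type*} [DecidableEq X] [DecidableEq Y]

theorem addHom_ext_single {G M : Type*} [Group G] [AddCommGroup M] {f g : MonoidAlgebra ℤ G →+ M}
    (h : ∀ x, f (MonoidAlgebra.single x 1) = g (MonoidAlgebra.single x 1)) : f = g := by
  refine AddMonoidHom.ext fun x => ?_
  induction x using MonoidAlgebra.induction_on with
  | of m => exact h m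
  | add x y hx hy => rw [map_add, map_add, hx, hy]
  | smul r x hx => rw [map_zsmul, map_zsmul, hx]

theorem single_inv_mul_single {G : Type*} [Group G] (g : G) :
    (MonoidAlgebra.single g⁻¹ 1 * MonoidAlgebra.single g 1 : MonoidAlgebra ℤ G) = 1 := by
  rw [MonoidAlgebra.single_mul_single, inv_mul_cancel, one_mul, MonoidAlgebra.one_def]

theorem mapDomainRingHom_single {G H : Type*} [Group G] [Group H] (φ : G →* H) (g : G) :
    MonoidAlgebra.mapDomainRingHom ℤ φ (MonoidAlgebra.single g 1) = MonoidAlgebra.single (φ g) 1 := by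
  rw [MonoidAlgebra.mapDomainRingHom_apply, MonoidAlgebra.mapDomain_single]

theorem single_mul {G : Type*} [Group G] (g h : G) :
    (MonoidAlgebra.single (g * h) 1 : MonoidAlgebra ℤ G) =
      MonoidAlgebra.single g 1 * MonoidAlgebra.single h 1 := by
  rw [MonoidAlgebra.single_mul_single, one_mul]

theorem fox_inv (k : X) (g : FreeGroup X) :
    fox k g⁻¹ = -(MonoidAlgebra.single g⁻¹ 1 * fox k g) := by
  have h := fox_mul k g⁻¹ g
  rw [inv_mul_cancel, fox_one] at h
  exact eq_neg_of_add_eq_zero_left h.symm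

/-- The chain rule for Fox derivatives. -/
theorem fox_map [Fintype X] (k : Y) (φ : FreeGroup X →* FreeGroup Y) (w : FreeGroup X) :
    fox k (φ w) =
      ∑ l, MonoidAlgebra.mapDomainRingHom ℤ φ (fox l w) * fox k (φ (FreeGroup.of l)) := by
  induction w using FreeGroup.induction_on with
  | C1 => simp [fox_one]
  | of x => simp [fox_of, apply_ite (MonoidAlgebra.mapDomainRingHom ℤ φ)]
  | inv_of x ih =>
    rw [map_inv, fox_inv, ih, Finset.mul_sum, ← Finset.sum_neg_distrib]
    refine Finset.sum_congr rfl fun l _ => ?_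
    rw [fox_inv, map_neg, map_mul, mapDomainRingHom_single, map_inv, neg_mul, mul_assoc]
  | mul x y hx hy =>
    rw [map_mul, fox_mul, hx, hy, Finset.mul_sum, ← Finset.sum_add_distrib]
    refine Finset.sum_congr rfl fun l _ => ?_
    rw [fox_mul, map_add, map_mul, mapDomainRingHom_single, add_mul, mul_assoc]

/-- The fundamental formula of Fox calculus. -/
theorem sum_fox_mul [Fintype X] (w : FreeGroup X) :
    ∑ k, fox k w * (MonoidAlgebra.single (FreeGroup.of k) 1 - 1) =
      MonoidAlgebra.single w 1 - 1 := by
  induction w using FreeGroup.induction_on with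
  | C1 => simp [fox_one, MonoidAlgebra.one_def]
  | of x => simp [fox_of]
  | inv_of x ih =>
    simp only [fox_inv, neg_mul, Finset.sum_neg_distrib, mul_assoc]
    rw [← Finset.mul_sum, ih, mul_sub, single_inv_mul_single]
    simp
  | mul x y hx hy =>
    simp only [fox_mul, add_mul, mul_assoc, Finset.sum_add_distrib]
    rw [← Finset.mul_sum, hx, hy, single_mul, mul_sub, mul_one]
    abel

end FoxCalculus

/-! ### The Magnus representation -/

section Magnus

variable {n ℓ : ℕ}

theorem pureBraid_induction {C : PureBraid n → Prop} (x : PureBraid n)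
    (of : ∀ p : Pair n, C (PresentedGroup.of p)) (one : C 1)
    (mul : ∀ x y, C x → C y → C (x * y)) (inv : ∀ x, C x → C x⁻¹) : C x := by
  have hx : x ∈ Subgroup.closure (Set.range (PresentedGroup.of (rels := pureBraidRels n))) := by
    rw [PresentedGroup.closure_range_of]; trivial
  induction hx using Subgroup.closure_induction with
  | mem x hx => obtain ⟨p, rfl⟩ := hx; exact of p
  | one => exact one
  | mul x y _ _ hx hy => exact mul x y hx hy
  | inv x _ hx => exact inv x hx

theorem artin_mul_apply (j : Fin n) (x y : PureBraid n) (w : FreeGroup (Below j)) :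
    (artin j (x * y)).unop w = (artin j y).unop ((artin j x).unop w) := by
  rw [map_mul, MulOpposite.unop_mul, MulAut.mul_apply]

/-- In `P_{n,ℓ}`, a braid acts on the free group `G_j` by conjugation. -/
theorem fibre_artin (j : Fin n) (hj : ℓ ≤ (j : ℕ)) (γ : PureBraid n) (w : FreeGroup (Below j)) :
    (fibre j hj ((artin j γ).unop w) : PureBraid n) =
      (retract j γ)⁻¹ * (fibre j hj w : PureBraid n) * retract j γ := by
  induction γ using pureBraid_induction generalizing w with
  | of p =>
    rw [artin_of, retract_of]
    split_ifs with h
    · have key : ((DiscrGroup n ℓ).subtype.comp (fibre j hj)).comp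
          (artinAut (⟨p.1.1, p.2.trans h⟩ : Below j) ⟨p.1.2, h⟩ p.2).toMonoidHom =
          (MulAut.conj (PresentedGroup.of p)⁻¹).toMonoidHom.comp
            ((DiscrGroup n ℓ).subtype.comp (fibre j hj)) := by
        ext i
        have rel := PresentedGroup.one_of_mem (rels := pureBraidRels n)
          ⟨j, ⟨p.1.1, p.2.trans h⟩, ⟨p.1.2, h⟩, i, p.2, rfl⟩
        simp only [map_mul, map_inv, map_conjugator, mul_inv_eq_one] at rel
        have e : ∀ a : Below j, (DiscrGroup n ℓ).subtype (fibre j hj (FreeGroup.of a)) =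
            PresentedGroup.of ⟨(a.1, j), a.2⟩ := fun a => by simp [fibre, gen]
        change (DiscrGroup n ℓ).subtype (fibre j hj (artinHom _ _ (FreeGroup.of i))) =
          (PresentedGroup.of p)⁻¹ * (DiscrGroup n ℓ).subtype (fibre j hj (FreeGroup.of i)) *
            (PresentedGroup.of p)⁻¹⁻¹
        rw [artinHom_of]
        simp only [map_mul, map_inv, map_conjugator, e, inv_inv]
        exact rel.symm
      have := DFunLike.congr_fun key w
      simpa using this
    · simp
  | one => simp
  | mul x y hx hy => rw [artin_mul_apply, hy, hx, map_mul]; group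
  | inv x hx =>
    have := hx ((artin j x⁻¹).unop w)
    rw [← artin_mul_apply, inv_mul_cancel, map_one] at this
    change (fibre j hj w : PureBraid n) = _ at this
    rw [this, map_inv (retract j), inv_inv]
    simp only [mul_assoc, mul_inv_cancel_left, mul_inv_cancel, mul_one]

/-- The ring homomorphism of group rings induced by `G_j → P_{n,ℓ}`. -/
noncomputable abbrev fibreRing (j : Fin n) (hj : ℓ ≤ (j : ℕ)) :
    MonoidAlgebra ℤ (FreeGroup (Below j)) →+* GroupRing n ℓ :=
  MonoidAlgebra.mapDomainRingHom ℤ (fibre j hj)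

/-- The ring homomorphism of `R` induced by forgetting the strands `≥ j`. -/
noncomputable abbrev retractRing (j : Fin n) (hj : ℓ ≤ (j : ℕ)) : GroupRing n ℓ →+* GroupRing n ℓ :=
  MonoidAlgebra.mapDomainRingHom ℤ (retractDiscr j hj)

theorem single_mul_fibreRing_artin (j : Fin n) (hj : ℓ ≤ (j : ℕ)) (γ : DiscrGroup n ℓ)
    (x : MonoidAlgebra ℤ (FreeGroup (Below j))) :
    MonoidAlgebra.single (retractDiscr j hj γ) 1 * fibreRing j hj
        (MonoidAlgebra.mapDomainRingHom ℤ (artin j (γ : PureBraid n)).unop.toMonoidHom x) =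
      fibreRing j hj x * MonoidAlgebra.single (retractDiscr j hj γ) 1 := by
  have key : (AddMonoidHom.mulLeft (MonoidAlgebra.single (retractDiscr j hj γ) 1)).comp
      ((fibreRing j hj).comp (MonoidAlgebra.mapDomainRingHom ℤ
        (artin j (γ : PureBraid n)).unop.toMonoidHom)).toAddMonoidHom =
      (AddMonoidHom.mulRight (MonoidAlgebra.single (retractDiscr j hj γ) 1)).comp
        (fibreRing j hj).toAddMonoidHom := by
    refine addHom_ext_single fun w => ?_
    change MonoidAlgebra.single (retractDiscr j hj γ) 1 * fibreRing j hj
      (MonoidAlgebra.mapDomainRingHom ℤ (artin j (γ : PureBraid n)).unop.toMonoidHom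
        (MonoidAlgebra.single w 1)) = fibreRing j hj (MonoidAlgebra.single w 1) *
          MonoidAlgebra.single (retractDiscr j hj γ) 1
    rw [mapDomainRingHom_single, mapDomainRingHom_single, mapDomainRingHom_single,
      ← single_mul, ← single_mul]
    congr 1
    apply Subtype.ext
    change retract j (γ : PureBraid n) * (fibre j hj ((artin j (γ : PureBraid n)).unop w) :
      PureBraid n) = (fibre j hj w : PureBraid n) * retract j (γ : PureBraid n)
    rw [fibre_artin]
    group
  exact DFunLike.congr_fun key x

/-- `ρ_j` is multiplicative: the chain rule, together with the action of braids on `G_j` by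
conjugation. -/
theorem rho_mul (j : Fin n) (hj : ℓ ≤ (j : ℕ)) (x y : DiscrGroup n ℓ) :
    rho j hj (x * y) = rho j hj x * rho j hj y := by
  refine Matrix.ext fun i k => ?_
  rw [Matrix.mul_apply]
  simp only [rho, Matrix.of_apply]
  rw [Subgroup.coe_mul, artin_mul_apply]
  have := fox_map k (artin j (y : PureBraid n)).unop.toMonoidHom
    ((artin j (x : PureBraid n)).unop (FreeGroup.of i))
  rw [show (artin j (y : PureBraid n)).unop ((artin j (x : PureBraid n)).unop (FreeGroup.of i)) =
    (artin j (y : PureBraid n)).unop.toMonoidHom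
      ((artin j (x : PureBraid n)).unop (FreeGroup.of i)) from rfl, this,
    map_sum (MonoidAlgebra.mapDomainRingHom ℤ (fibre j hj)), Finset.mul_sum]
  refine Finset.sum_congr rfl fun l _ => ?_
  have h2 := single_mul_fibreRing_artin j hj y
    (fox l ((artin j (x : PureBraid n)).unop (FreeGroup.of i)))
  rw [map_mul (retractDiscr j hj), single_mul, map_mul (MonoidAlgebra.mapDomainRingHom ℤ _),
    ← mul_assoc, mul_assoc (MonoidAlgebra.single (retractDiscr j hj x) 1), h2]
  simp only [mul_assoc]
  rfl

theorem rhoRing_single (j : Fin n) (hj : ℓ ≤ (j : ℕ)) (γ : DiscrGroup n ℓ) :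
    rhoRing j hj (MonoidAlgebra.single γ 1) = rho j hj γ := by
  rw [rhoRing, MonoidAlgebra.liftNC_single]; simp

theorem rhoRing_mul (j : Fin n) (hj : ℓ ≤ (j : ℕ)) (x y : GroupRing n ℓ) :
    rhoRing j hj (x * y) = rhoRing j hj x * rhoRing j hj y := by
  induction x using MonoidAlgebra.induction_on with
  | add x x' hx hx' => rw [add_mul, map_add, hx, hx', map_add, add_mul]
  | smul r x hx => rw [smul_mul_assoc, map_zsmul, hx, map_zsmul, smul_mul_assoc]
  | of g =>
    induction y using MonoidAlgebra.induction_on with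
    | add x x' hx hx' => rw [mul_add, map_add, hx, hx', map_add, mul_add]
    | smul r x hx => rw [mul_smul_comm, map_zsmul, hx, map_zsmul, mul_smul_comm]
    | of h =>
      rw [MonoidAlgebra.of_apply, MonoidAlgebra.of_apply, ← single_mul, rhoRing_single,
        rhoRing_single, rhoRing_single, rho_mul]

/-- `ρ_j(x) Δ_{{j}} = Δ_{{j}} x'`, where `x'` is the image of `x` under forgetting the strands `≥ j`. -/
theorem sum_rhoRing_mul (j : Fin n) (hj : ℓ ≤ (j : ℕ)) (x : GroupRing n ℓ) (i : Below j) :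
    ∑ k : Below j, rhoRing j hj x i k * (MonoidAlgebra.single (gen ⟨(k.1, j), k.2, hj⟩) 1 - 1) =
      (MonoidAlgebra.single (gen ⟨(i.1, j), i.2, hj⟩) 1 - 1) * retractRing j hj x := by
  have e : ∀ k : Below j, fibre (ℓ := ℓ) j hj (FreeGroup.of k) = gen ⟨(k.1, j), k.2, hj⟩ :=
    fun k => by simp [fibre]
  induction x using MonoidAlgebra.induction_on with
  | add x x' hx hx' =>
    simp only [map_add, Matrix.add_apply, add_mul, Finset.sum_add_distrib, hx, hx', mul_add]
  | smul r x hx =>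
    simp only [map_zsmul, Matrix.smul_apply, smul_mul_assoc, ← Finset.smul_sum, hx, mul_smul_comm]
  | of γ =>
    rw [MonoidAlgebra.of_apply, rhoRing_single, retractRing, mapDomainRingHom_single]
    simp only [rho, Matrix.of_apply, mul_assoc]
    rw [← Finset.mul_sum]
    have h := congrArg (fibreRing j hj)
      (sum_fox_mul ((artin j (γ : PureBraid n)).unop (FreeGroup.of i)))
    simp only [map_sum, map_mul, map_sub, map_one, mapDomainRingHom_single, e] at h
    rw [h, mul_sub, sub_mul, one_mul, mul_one]
    congr 1
    have h2 := single_mul_fibreRing_artin j hj γ (MonoidAlgebra.single (FreeGroup.of i) 1)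
    rw [mapDomainRingHom_single, mapDomainRingHom_single, mapDomainRingHom_single, e] at h2
    exact h2

theorem retractDiscr_gen (m : Fin n) (hm : ℓ ≤ (m : ℕ)) (h : Hyp n ℓ) (hh : h.1.2 < m) :
    retractDiscr m hm (gen h) = gen h := by
  apply Subtype.ext
  change retract m (PresentedGroup.of _) = PresentedGroup.of _
  rw [retract_of, if_pos hh]

theorem retractDiscr_fibre {j m : Fin n} (hj : ℓ ≤ (j : ℕ)) (hm : ℓ ≤ (m : ℕ)) (hjm : j < m)
    (w : FreeGroup (Below j)) : retractDiscr m hm (fibre j hj w) = fibre j hj w := by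
  have : (retractDiscr m hm).comp (fibre j hj) = fibre (ℓ := ℓ) j hj := by
    ext i : 1
    simp [fibre, retractDiscr_gen m hm ⟨(i.1, j), i.2, hj⟩ hjm]
  exact DFunLike.congr_fun this w

theorem retractDiscr_retractDiscr {j m : Fin n} (hj : ℓ ≤ (j : ℕ)) (hm : ℓ ≤ (m : ℕ)) (hjm : j < m)
    (γ : DiscrGroup n ℓ) : retractDiscr m hm (retractDiscr j hj γ) = retractDiscr j hj γ := by
  have : (retract m).comp (retract j) = retract j := by
    refine PresentedGroup.ext fun p => ?_
    rw [MonoidHom.comp_apply, retract_of]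
    split_ifs with h
    · rw [retract_of, if_pos (h.trans hjm)]
    · exact map_one _
  exact Subtype.ext (DFunLike.congr_fun this (γ : PureBraid n))

theorem retractRing_rhoRing {j m : Fin n} (hj : ℓ ≤ (j : ℕ)) (hm : ℓ ≤ (m : ℕ)) (hjm : j < m)
    (x : GroupRing n ℓ) (i k : Below j) :
    retractRing m hm (rhoRing j hj x i k) = rhoRing j hj x i k := by
  induction x using MonoidAlgebra.induction_on with
  | add x x' hx hx' => rw [map_add, Matrix.add_apply, map_add, hx, hx']
  | smul r x hx => rw [map_zsmul, Matrix.smul_apply, map_zsmul, hx]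
  | of γ =>
    have h : ∀ y, retractRing m hm (fibreRing j hj y) = fibreRing j hj y := by
      have key : ((retractRing m hm).comp (fibreRing (ℓ := ℓ) j hj)).toAddMonoidHom =
          (fibreRing j hj).toAddMonoidHom := by
        refine addHom_ext_single fun w => ?_
        change retractRing m hm (fibreRing j hj _) = fibreRing j hj _
        rw [mapDomainRingHom_single, mapDomainRingHom_single, retractDiscr_fibre hj hm hjm]
      exact fun y => DFunLike.congr_fun key y
    rw [MonoidAlgebra.of_apply, rhoRing_single]
    simp only [rho, Matrix.of_apply, map_mul, h]
    rw [mapDomainRingHom_single, retractDiscr_retractDiscr hj hm hjm]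

end Magnus

/-! ### The recursion for the boundary matrices -/

section Boundary

variable {n ℓ : ℕ}

namespace Idx

/-- The index `(I, J)` without its last pair. -/
def init {q : ℕ} (b : Idx n ℓ (q + 1)) : Idx n ℓ q :=
  ⟨fun s => b.1 s.castSucc, fun _ _ h => b.2 (Fin.castSucc_lt_castSucc_iff.mpr h)⟩

/-- The last pair of the index `(I, J)`. -/
def last {q : ℕ} (b : Idx n ℓ (q + 1)) : Hyp n ℓ := b.1 (Fin.last q)

/-- The index `(I, J)` extended by a pair whose second strand is above `J`. -/
def snoc {q : ℕ} (b : Idx n ℓ q) (h : Hyp n ℓ) (hb : ∀ s, (b.1 s).1.2 < h.1.2) :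
    Idx n ℓ (q + 1) :=
  ⟨Fin.snoc (α := fun _ => Hyp n ℓ) b.1 h, by
    intro s t hst
    induction t using Fin.lastCases with
    | last =>
      induction s using Fin.lastCases with
      | last => exact absurd hst (lt_irrefl _)
      | cast s => simpa using hb s
    | cast t =>
      induction s using Fin.lastCases with
      | last => exact absurd hst (not_lt.mpr (Fin.le_last _))
      | cast s => simpa using b.2 (Fin.castSucc_lt_castSucc_iff.mp hst)⟩

@[simp] theorem init_snoc {q : ℕ} (b : Idx n ℓ q) (h : Hyp n ℓ) (hb) : (b.snoc h hb).init = b :=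
  Subtype.ext (funext fun s => by simp [init, snoc])

@[simp] theorem last_snoc {q : ℕ} (b : Idx n ℓ q) (h : Hyp n ℓ) (hb) : (b.snoc h hb).last = h := by
  simp [last, snoc]

theorem init_lt_last {q : ℕ} (b : Idx n ℓ (q + 1)) (s : Fin q) :
    (b.init.1 s).1.2 < b.last.1.2 := b.2 (Fin.castSucc_lt_last s)

theorem le_last {q : ℕ} (b : Idx n ℓ (q + 1)) (s : Fin (q + 1)) :
    (b.1 s).1.2 ≤ b.last.1.2 := b.2.monotone (Fin.le_last s)

theorem lt_iff_last_lt {q : ℕ} (b : Idx n ℓ (q + 1)) (m : Fin n) :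
    (∀ s, (b.1 s).1.2 < m) ↔ b.last.1.2 < m :=
  ⟨fun h => h _, fun h s => (b.le_last s).trans_lt h⟩

theorem ext_init_last {q : ℕ} {b c : Idx n ℓ (q + 1)} (h : b.init = c.init) (h' : b.last = c.last) :
    b = c := by
  refine Subtype.ext (funext fun s => ?_)
  induction s using Fin.lastCases with
  | last => exact h'
  | cast s => exact congrFun (congrArg Subtype.val h) s

end Idx

theorem rhoEntry_zero (r c : Hyp n ℓ) : rhoEntry r c 0 = 0 := by
  unfold rhoEntry; split_ifs <;> simp

theorem rhoEntry_sum {ι : Type*} (s : Finset ι) (r c : Hyp n ℓ) (f : ι → GroupRing n ℓ) :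
    rhoEntry r c (∑ i ∈ s, f i) = ∑ i ∈ s, rhoEntry r c (f i) := by
  unfold rhoEntry
  split_ifs
  · rw [map_sum, Matrix.sum_apply]
  · simp

theorem rhoEntry_of_ne {r c : Hyp n ℓ} (h : c.1.2 ≠ r.1.2) (x : GroupRing n ℓ) :
    rhoEntry r c x = 0 := dif_neg h

theorem rhoEntry_mk (m : Fin n) (hm : ℓ ≤ (m : ℕ)) (i k : Below m) (x : GroupRing n ℓ) :
    rhoEntry ⟨(i.1, m), i.2, hm⟩ ⟨(k.1, m), k.2, hm⟩ x = rhoRing m hm x i k := dif_pos rfl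

theorem blockEntry_congr {m m' : ℕ} (h : m = m') {r : Fin (m + 1) → Hyp n ℓ}
    {r' : Fin (m' + 1) → Hyp n ℓ} {c : Fin m → Hyp n ℓ} {c' : Fin m' → Hyp n ℓ}
    (hr : ∀ s : Fin (m + 1), r s = r' (s.cast (by omega))) (hc : ∀ s : Fin m, c s = c' (s.cast h)) :
    blockEntry m r c = blockEntry m' r' c' := by
  subst h
  rw [show r = r' from funext hr, show c = c' from funext hc]

theorem boundaryMatrix_zero (r : Idx n ℓ 1) (c : Idx n ℓ 0) :
    boundaryMatrix n ℓ 0 r c = MonoidAlgebra.single (gen r.last) 1 - 1 := by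
  simp [boundaryMatrix, blockEntry]
  rfl

/-- The recursion for the boundary matrices: the matrix of `∂` on `C^J`, for `J` with last element
`j`, consists of `-ρ_j` of the matrix of `∂` on `C^{J ∖ {j}}` and of copies of `Δ_{{j}}`. -/
theorem boundaryMatrix_succ (q : ℕ) (r : Idx n ℓ (q + 2)) (c : Idx n ℓ (q + 1)) :
    boundaryMatrix n ℓ (q + 1) r c =
      -rhoEntry r.last c.last (boundaryMatrix n ℓ q r.init c.init) +
        if c = r.init then MonoidAlgebra.single (gen r.last) 1 - 1 else 0 := by
  simp only [boundaryMatrix, Matrix.of_apply]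
  rw [Fin.sum_univ_castSucc, rhoEntry_sum, ← Finset.sum_neg_distrib]
  congr 1
  · refine Finset.sum_congr rfl fun p _ => ?_
    by_cases hl : c.last.1.2 = r.last.1.2
    · have e : ((∀ s : Fin (q + 1), (c.1 s).1.2 = (r.1 (p.castSucc.succAbove s)).1.2) ∧
          (∀ s : Fin (q + 1), s.castSucc < p.castSucc → c.1 s = r.1 s.castSucc)) ↔
          ((∀ s : Fin q, (c.init.1 s).1.2 = (r.init.1 (p.succAbove s)).1.2) ∧
            (∀ s : Fin q, s.castSucc < p → c.init.1 s = r.init.1 s.castSucc)) := by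
        simp only [Fin.forall_fin_succ' (n := q), Fin.castSucc_succAbove_castSucc]
        refine and_congr (and_iff_left ?_) (and_iff_left ?_)
        · rw [Fin.succAbove_of_le_castSucc _ _ (Fin.castSucc_le_castSucc_iff.mpr (Fin.le_last p))]
          exact hl
        · intro h
          exact absurd (Fin.le_last p) (not_le.mpr (Fin.castSucc_lt_castSucc_iff.mp h))
      rw [if_congr e rfl rfl]
      split_ifs
      · have hp : q + 1 - (p : ℕ) = (q - p) + 1 := by omega
        refine (blockEntry_congr (r' := fun s => r.1 ⟨p + s, by omega⟩)
          (c' := fun s => c.1 ⟨p + s, by omega⟩) hp (fun s => rfl) (fun s => rfl)).trans ?_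
        rw [blockEntry]
        have e1 : (⟨p + (Fin.last (q - p + 1) : Fin _), by simp; omega⟩ : Fin (q + 2)) =
          Fin.last (q + 1) := Fin.ext (by simp; omega)
        have e2 : (⟨p + (Fin.last (q - p) : Fin _), by simp; omega⟩ : Fin (q + 1)) =
          Fin.last q := Fin.ext (by simp; omega)
        simp only [e1, e2]
        rfl
      · rw [rhoEntry_zero, neg_zero]
    · rw [rhoEntry_of_ne hl, neg_zero, if_neg]
      rintro ⟨h, -⟩
      apply hl
      have := h (Fin.last q)
      rwa [Fin.succAbove_of_le_castSucc _ _ (Fin.castSucc_le_castSucc_iff.mpr (Fin.le_last p))]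
        at this
  · have e : ((∀ s : Fin (q + 1), (c.1 s).1.2 = (r.1 ((Fin.last (q + 1)).succAbove s)).1.2) ∧
          (∀ s : Fin (q + 1), s.castSucc < Fin.last (q + 1) → c.1 s = r.1 s.castSucc)) ↔
        c = r.init := by
      refine ⟨fun h => Subtype.ext (funext fun s => h.2 s (Fin.castSucc_lt_last s)), ?_⟩
      rintro rfl
      refine ⟨fun s => ?_, fun s _ => rfl⟩
      rw [Fin.succAbove_last]
      rfl
    rw [if_congr e rfl rfl]
    split_ifs
    · rw [blockEntry_congr (m' := 0) (r' := fun _ => r.last) (c' := fun s => s.elim0) (by simp)]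
      · rfl
      · intro s
        change r.1 _ = r.1 _
        exact congrArg r.1 (Fin.ext (by simp; omega))
      · intro s
        exact absurd s.2 (by simp)
    · rfl

theorem boundaryMatrix_eq_zero {q : ℕ} (r : Idx n ℓ (q + 1)) (c : Idx n ℓ q) {m : Fin n}
    (hr : ∀ s, (r.1 s).1.2 < m) (hc : ¬ ∀ s, (c.1 s).1.2 < m) : boundaryMatrix n ℓ q r c = 0 := by
  cases q with
  | zero => exact absurd (fun s => s.elim0) hc
  | succ q =>
    rw [Idx.lt_iff_last_lt] at hr hc
    rw [boundaryMatrix_succ, rhoEntry_of_ne (r := r.last) (c := c.last) fun h => hc (h ▸ hr), if_neg, neg_zero, add_zero]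
    rintro rfl
    exact hc ((r.init_lt_last _).trans hr)

theorem retractRing_boundaryMatrix {q : ℕ} (r : Idx n ℓ (q + 1)) (c : Idx n ℓ q) {m : Fin n}
    (hm : ℓ ≤ (m : ℕ)) (hr : ∀ s, (r.1 s).1.2 < m) :
    retractRing m hm (boundaryMatrix n ℓ q r c) = boundaryMatrix n ℓ q r c := by
  rw [Idx.lt_iff_last_lt] at hr
  have hg : retractRing m hm (MonoidAlgebra.single (gen r.last) 1 - 1) =
      MonoidAlgebra.single (gen r.last) 1 - 1 := by
    rw [map_sub, map_one, mapDomainRingHom_single, retractDiscr_gen m hm _ hr]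
  cases q with
  | zero => rw [boundaryMatrix_zero, hg]
  | succ q =>
    rw [boundaryMatrix_succ, map_add, map_neg, apply_ite (retractRing m hm), hg, map_zero]
    congr 2
    unfold rhoEntry
    split_ifs
    · exact retractRing_rhoRing r.last.2.2 hm hr _ _ _
    · exact map_zero _

/-- Indices of length `q + 1` with last strand `m` are pairs of an index of length `q` below `m` and
a strand below `m`. -/
theorem sum_idx_succ {M : Type*} [AddCommMonoid M] {q : ℕ} (m : Fin n) (hm : ℓ ≤ (m : ℕ))
    (f : Idx n ℓ (q + 1) → M) (g : Idx n ℓ q → Below m → M)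
    (hf : ∀ b, b.last.1.2 ≠ m → f b = 0)
    (hg : ∀ b k, (¬ ∀ s, (b.1 s).1.2 < m) → g b k = 0)
    (hfg : ∀ b (k : Below m) (hb : ∀ s, (b.1 s).1.2 < m),
      f (b.snoc ⟨(k.1, m), k.2, hm⟩ hb) = g b k) :
    ∑ b, f b = ∑ b, ∑ k, g b k := by
  classical
  rw [← Finset.sum_product' (f := g)]
  have hlast : ∀ b : Idx n ℓ (q + 1), f b ≠ 0 → b.last.1.2 = m := fun b h => by
    by_contra h'; exact h (hf b h')
  symm
  refine Finset.sum_bij_ne_zero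
    (fun p _ hp => p.1.snoc ⟨(p.2.1, m), p.2.2, hm⟩ (by by_contra h; exact hp (hg _ _ h)))
    (fun _ _ _ => Finset.mem_univ _) ?_ ?_ ?_
  · rintro ⟨b, k⟩ _ hp ⟨b', k'⟩ _ hp' h
    have h1 := congrArg Idx.init h
    have h2 := congrArg (fun h : Hyp n ℓ => h.1.1) (congrArg Idx.last h)
    simp only [Idx.init_snoc, Idx.last_snoc] at h1 h2
    exact Prod.ext h1 (Subtype.ext h2)
  · intro b _ hb
    obtain rfl := hlast b hb
    have hs : b.init.snoc ⟨(b.last.1.1, b.last.1.2), b.last.2.1, hm⟩ b.init_lt_last = b :=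
      Idx.ext_init_last (Idx.init_snoc _ _ _) (Idx.last_snoc _ _ _)
    have h := hfg b.init ⟨b.last.1.1, b.last.2.1⟩ b.init_lt_last
    rw [hs] at h
    exact ⟨(b.init, ⟨b.last.1.1, b.last.2.1⟩), Finset.mem_univ _, h ▸ hb, hs⟩
  · rintro ⟨b, k⟩ _ hp
    exact (hfg _ _ _).symm

theorem boundaryMatrix_mul_apply (q : ℕ) (a : Idx n ℓ (q + 2)) (c : Idx n ℓ q) :
    (boundaryMatrix n ℓ (q + 1) * boundaryMatrix n ℓ q) a c =
      -∑ b : Idx n ℓ (q + 1), rhoEntry a.last b.last (boundaryMatrix n ℓ q a.init b.init) *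
          boundaryMatrix n ℓ q b c +
        (MonoidAlgebra.single (gen a.last) 1 - 1) * boundaryMatrix n ℓ q a.init c := by
  simp only [Matrix.mul_apply, boundaryMatrix_succ, add_mul, Finset.sum_add_distrib, neg_mul,
    Finset.sum_neg_distrib, ite_mul, zero_mul, Finset.sum_ite_eq', Finset.mem_univ, if_true]

/-- The boundary matrices form a complex. -/
theorem boundaryMatrix_mul (n ℓ q : ℕ) :
    boundaryMatrix n ℓ (q + 1) * boundaryMatrix n ℓ q = 0 := by
  induction q with
  | zero =>
    refine Matrix.ext fun a c => ?_
    rw [boundaryMatrix_mul_apply, sum_idx_succ a.last.1.2 a.last.2.2 _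
      (fun b k => rhoRing a.last.1.2 a.last.2.2 (boundaryMatrix n ℓ 0 a.init b)
        ⟨a.last.1.1, a.last.2.1⟩ k *
          (MonoidAlgebra.single (gen ⟨(k.1, a.last.1.2), k.2, a.last.2.2⟩) 1 - 1))]
    · simp only [sum_rhoRing_mul]
      rw [Fintype.sum_eq_single c fun b hb => absurd (Subsingleton.elim b c) hb,
        retractRing_boundaryMatrix _ _ _ a.init_lt_last]
      exact neg_add_cancel _
    · intro b hb
      rw [rhoEntry_of_ne hb, zero_mul]
    · intro b k hb
      exact absurd (fun s => s.elim0) hb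
    · intro b k hb
      rw [Idx.init_snoc, Idx.last_snoc, boundaryMatrix_zero (b.snoc ⟨(k.1, a.last.1.2), k.2, a.last.2.2⟩ hb), Idx.last_snoc]
      congr 1
      exact rhoEntry_mk _ a.last.2.2 ⟨a.last.1.1, a.last.2.1⟩ k _
  | succ q ih =>
    refine Matrix.ext fun a c => ?_
    set m := a.last.1.2 with hm
    set i : Below m := ⟨a.last.1.1, a.last.2.1⟩ with hi
    have hla : a.last = ⟨(i.1, m), i.2, a.last.2.2⟩ := rfl
    rw [boundaryMatrix_mul_apply, sum_idx_succ m a.last.2.2 _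
      (fun b k => rhoRing m a.last.2.2 (boundaryMatrix n ℓ (q + 1) a.init b) i k *
          -rhoEntry ⟨(k.1, m), k.2, a.last.2.2⟩ c.last (boundaryMatrix n ℓ q b c.init) +
        if c = b then rhoRing m a.last.2.2 (boundaryMatrix n ℓ (q + 1) a.init b) i k *
          (MonoidAlgebra.single (gen ⟨(k.1, m), k.2, a.last.2.2⟩) 1 - 1) else 0)]
    · simp only [Finset.sum_add_distrib]
      rw [Finset.sum_comm (f := fun b k => if c = b then _ else _)]
      simp only [Finset.sum_ite_eq, Finset.mem_univ, if_true]
      rw [sum_rhoRing_mul, retractRing_boundaryMatrix _ _ _ a.init_lt_last, neg_add, add_assoc,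
        ← hla, neg_add_cancel, add_zero, Matrix.zero_apply, neg_eq_zero]
      simp only [mul_neg, Finset.sum_neg_distrib, neg_eq_zero]
      by_cases hc : c.last.1.2 = m
      · -- the terms with `c = b` have cancelled; `ρ_m` is multiplicative, so induction applies
        obtain ⟨k', hk'⟩ : ∃ k' : Below m, c.last = ⟨(k'.1, m), k'.2, a.last.2.2⟩ :=
          ⟨⟨c.last.1.1, hc ▸ c.last.2.1⟩, Subtype.ext (Prod.ext rfl hc)⟩
        simp only [hk']
        calc _ = rhoRing m a.last.2.2 (∑ b, boundaryMatrix n ℓ (q + 1) a.init b *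
              boundaryMatrix n ℓ q b c.init) i k' := by
              rw [map_sum, Matrix.sum_apply]
              exact Finset.sum_congr rfl fun b _ => by
                rw [rhoRing_mul, Matrix.mul_apply]
                exact Finset.sum_congr rfl fun k _ => by rw [rhoEntry_mk]
          _ = 0 := by
              rw [← Matrix.mul_apply, ih, Matrix.zero_apply, map_zero, Matrix.zero_apply]
      · exact Finset.sum_eq_zero fun b _ => Finset.sum_eq_zero fun k _ => by
          rw [rhoEntry_of_ne (by exact hc), mul_zero]
    · intro b hb
      rw [rhoEntry_of_ne hb, zero_mul]
    · intro b k hb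
      rw [boundaryMatrix_eq_zero a.init b a.init_lt_last hb]
      simp
    · intro b k hb
      rw [Idx.init_snoc, Idx.last_snoc, boundaryMatrix_succ q (b.snoc ⟨(k.1, m), k.2, a.last.2.2⟩ hb) c, Idx.last_snoc, Idx.init_snoc,
        show rhoEntry a.last ⟨(k.1, m), k.2, a.last.2.2⟩ (boundaryMatrix n ℓ (q + 1) a.init b) =
          rhoRing m a.last.2.2 (boundaryMatrix n ℓ (q + 1) a.init b) i k from
          rhoEntry_mk m a.last.2.2 i k _, mul_add, mul_ite, mul_zero]

end Boundary

/-! ### Exponent sums and characters -/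

section Exponents

variable {n ℓ : ℕ}

/-- The homomorphism of `P_n` to `ℤ` that counts the occurrences of `γ_{i,j}`, where `p = (i, j)`. -/
noncomputable def expo (p : Pair n) : PureBraid n →* Multiplicative ℤ :=
  PureBraid.lift (fun p' => Multiplicative.ofAdd (if p = p' then 1 else 0))
    (by intro k r s i h c g; rw [inv_mul_cancel_comm, mul_inv_cancel_comm])

theorem expo_of (p p' : Pair n) :
    expo p (PresentedGroup.of p') = Multiplicative.ofAdd (if p = p' then 1 else 0) :=
  PureBraid.lift_of _ _ _

theorem toAdd_hom_eq_sum {M : Type*} [AddCommGroup M] (φ : PureBraid n →* Multiplicative M)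
    (γ : PureBraid n) :
    (φ γ).toAdd = ∑ p : Pair n, (expo p γ).toAdd • (φ (PresentedGroup.of p)).toAdd := by
  induction γ using pureBraid_induction with
  | of p => simp [expo_of]
  | one => simp
  | mul x y hx hy => simp [hx, hy, add_smul, Finset.sum_add_distrib]
  | inv x hx => simp [hx, neg_smul]

/-- The generators of `P_ℓ` have exponent sum zero in the elements of `P_{n,ℓ} = ker (P_n → P_ℓ)`. -/
theorem expo_eq_one (γ : DiscrGroup n ℓ) (p : Pair n) (hp : (p.1.2 : ℕ) < ℓ) :
    expo p (γ : PureBraid n) = 1 := by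
  have hp1 : (p.1.1 : ℕ) < ℓ := lt_trans p.2 hp
  have key : expo p = (expo ⟨(⟨p.1.1, hp1⟩, ⟨p.1.2, hp⟩), p.2⟩).comp (forget n ℓ) := by
    refine PresentedGroup.ext fun p' => ?_
    rw [MonoidHom.comp_apply, expo_of, forget_of]
    split_ifs with h1 h2 h2
    · subst h1; rw [expo_of, if_pos rfl]
    · subst h1; exact absurd hp h2
    · rw [expo_of, if_neg]
      intro h
      apply h1
      simp only [Subtype.mk.injEq, Prod.mk.injEq, Fin.mk.injEq] at h
      exact Subtype.ext (Prod.ext (Fin.ext h.1) (Fin.ext h.2))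
    · rw [map_one]; rfl
  rw [key, MonoidHom.comp_apply, MonoidHom.mem_ker.mp γ.2, map_one]

/-- A homomorphism of `P_n` to an abelian group is given on `P_{n,ℓ}` by its values on the
generators `γ_{i,j}` with `j` not among the first `ℓ` strands. -/
theorem toAdd_hom_eq_sum_hyp {M : Type*} [AddCommGroup M] (φ : PureBraid n →* Multiplicative M)
    (γ : DiscrGroup n ℓ) :
    (φ γ).toAdd = ∑ h : Hyp n ℓ, (expo ⟨h.1, h.2.1⟩ (γ : PureBraid n)).toAdd • (φ (gen h)).toAdd := by
  rw [toAdd_hom_eq_sum]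
  symm
  refine Fintype.sum_of_injective (fun h : Hyp n ℓ => (⟨h.1, h.2.1⟩ : Pair n)) ?_ _ _ ?_ ?_
  · intro h h' e
    exact Subtype.ext (congrArg (fun p : Pair n => p.1) e)
  · intro p hp
    rw [expo_eq_one γ p, toAdd_one, zero_smul]
    by_contra h
    exact hp ⟨⟨p.1, p.2, not_lt.mp h⟩, rfl⟩
  · intro h
    rfl

/-- The additive character of `P_n` with `γ_{i,j} ↦ v_{i,j}` if `j` is not among the first `ℓ`
strands, and `γ_{i,j} ↦ 0` otherwise. -/
noncomputable def logCharacter (v : Hyp n ℓ → ℂ) : PureBraid n →* Multiplicative ℂ :=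
  PureBraid.lift (fun p => Multiplicative.ofAdd (if h : ℓ ≤ (p.1.2 : ℕ) then v ⟨p.1, p.2, h⟩ else 0))
    (by intro k r s i h c g; rw [inv_mul_cancel_comm, mul_inv_cancel_comm])

theorem logCharacter_of (v : Hyp n ℓ → ℂ) (p : Pair n) :
    (logCharacter v (PresentedGroup.of p)).toAdd =
      if h : ℓ ≤ (p.1.2 : ℕ) then v ⟨p.1, p.2, h⟩ else 0 := by
  rw [logCharacter, PureBraid.lift_of]; rfl

theorem logCharacter_gen (v : Hyp n ℓ → ℂ) (h : Hyp n ℓ) :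
    (logCharacter v (gen h)).toAdd = v h :=
  (logCharacter_of v ⟨h.1, h.2.1⟩).trans (dif_pos h.2.2)

theorem logCharacter_eq_sum (v : Hyp n ℓ → ℂ) (γ : DiscrGroup n ℓ) :
    (logCharacter v γ).toAdd =
      ∑ h : Hyp n ℓ, ((expo ⟨h.1, h.2.1⟩ (γ : PureBraid n)).toAdd : ℂ) * v h := by
  rw [toAdd_hom_eq_sum_hyp]
  exact Finset.sum_congr rfl fun h _ => by rw [logCharacter_gen, zsmul_eq_mul]

theorem ambientCharacter_expPoint (v : Hyp n ℓ → ℂ) (γ : PureBraid n) :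
    (ambientCharacter (expPoint v) γ : ℂ) = Complex.exp (logCharacter v γ).toAdd := by
  induction γ using pureBraid_induction with
  | of p =>
    rw [ambientCharacter_of, logCharacter_of]
    split_ifs <;> simp [expPoint]
  | one => simp
  | mul x y hx hy => simp [hx, hy, Complex.exp_add]
  | inv x hx => simp [hx, Complex.exp_neg]

theorem evalRing_single (t : Hyp n ℓ → ℂˣ) (γ : DiscrGroup n ℓ) :
    evalRing t (MonoidAlgebra.single γ 1) = (ambientCharacter t (γ : PureBraid n) : ℂ) := by
  simp [evalRing, MonoidAlgebra.liftNCRingHom, MonoidAlgebra.liftNC_single, character]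

theorem evalRing_expPoint_single (v : Hyp n ℓ → ℂ) (γ : DiscrGroup n ℓ) :
    evalRing (expPoint v) (MonoidAlgebra.single γ 1) =
      Complex.exp (∑ h : Hyp n ℓ, ((expo ⟨h.1, h.2.1⟩ (γ : PureBraid n)).toAdd : ℂ) * v h) := by
  rw [evalRing_single, ambientCharacter_expPoint, logCharacter_eq_sum]

theorem differentiable_evalRing (x : GroupRing n ℓ) :
    Differentiable ℂ fun v : Hyp n ℓ → ℂ => evalRing (expPoint v) x := by
  induction x using MonoidAlgebra.induction_on with
  | of γ =>
    simp only [MonoidAlgebra.of_apply, evalRing_expPoint_single]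
    fun_prop
  | add x y hx hy => simp only [map_add]; exact hx.add hy
  | smul r x hx => simp only [map_zsmul]; exact hx.const_smul r

theorem expPoint_zero : expPoint (0 : Hyp n ℓ → ℂ) = 1 := by
  funext h
  apply Units.ext
  simp [expPoint]

end Exponents

/-! ### Derivatives at the trivial character -/

section Derivative

variable {n ℓ : ℕ}

/-- The derivative, at the trivial character and in the direction `λ`, of the value of an element of
`R` at a character. -/
noncomputable def derivOne (lam : Hyp n ℓ → ℂ) (x : GroupRing n ℓ) : ℂ :=
  deriv (fun s : ℂ => evalRing (expPoint (s • lam)) x) 0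

theorem hasDerivAt_evalRing (lam : Hyp n ℓ → ℂ) (x : GroupRing n ℓ) :
    HasDerivAt (fun s : ℂ => evalRing (expPoint (s • lam)) x) (derivOne lam x) 0 := by
  have : Differentiable ℂ fun s : ℂ => evalRing (expPoint (s • lam)) x :=
    (differentiable_evalRing x).comp (differentiable_id.smul_const lam)
  exact (this 0).hasDerivAt

theorem derivOne_add (lam : Hyp n ℓ → ℂ) (x y : GroupRing n ℓ) :
    derivOne lam (x + y) = derivOne lam x + derivOne lam y := by
  have := (hasDerivAt_evalRing lam x).add (hasDerivAt_evalRing lam y)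
  refine HasDerivAt.deriv (this.congr_of_eventuallyEq (Filter.Eventually.of_forall fun s => ?_))
  simp

/-- `derivOne` as a homomorphism of additive groups. -/
noncomputable def derivOneHom (lam : Hyp n ℓ → ℂ) : GroupRing n ℓ →+ ℂ :=
  AddMonoidHom.mk' (derivOne lam) (derivOne_add lam)

theorem derivOne_neg (lam : Hyp n ℓ → ℂ) (x : GroupRing n ℓ) : derivOne lam (-x) = -derivOne lam x :=
  map_neg (derivOneHom lam) x

theorem derivOne_sub (lam : Hyp n ℓ → ℂ) (x y : GroupRing n ℓ) :
    derivOne lam (x - y) = derivOne lam x - derivOne lam y :=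
  map_sub (derivOneHom lam) x y

theorem derivOne_zero (lam : Hyp n ℓ → ℂ) : derivOne lam (0 : GroupRing n ℓ) = 0 :=
  map_zero (derivOneHom lam)

theorem derivOne_sum (lam : Hyp n ℓ → ℂ) {ι : Type*} (s : Finset ι) (f : ι → GroupRing n ℓ) :
    derivOne lam (∑ i ∈ s, f i) = ∑ i ∈ s, derivOne lam (f i) :=
  map_sum (derivOneHom lam) f s

theorem derivOne_mul (lam : Hyp n ℓ → ℂ) (x y : GroupRing n ℓ) :
    derivOne lam (x * y) = derivOne lam x * evalRing 1 y + evalRing 1 x * derivOne lam y := by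
  have := (hasDerivAt_evalRing lam x).mul (hasDerivAt_evalRing lam y)
  simp only [zero_smul, expPoint_zero] at this
  refine HasDerivAt.deriv (this.congr_of_eventuallyEq (Filter.Eventually.of_forall fun s => ?_))
  simp

theorem derivOne_single (lam : Hyp n ℓ → ℂ) (γ : DiscrGroup n ℓ) :
    derivOne lam (MonoidAlgebra.single γ 1) = (logCharacter lam γ).toAdd := by
  have h : ∀ s : ℂ, evalRing (expPoint (s • lam)) (MonoidAlgebra.single γ 1) =
      Complex.exp (s * (logCharacter lam γ).toAdd) := fun s => by
    rw [evalRing_expPoint_single, logCharacter_eq_sum, Finset.mul_sum]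
    exact congrArg _ (Finset.sum_congr rfl fun h _ => by simp; ring)
  rw [derivOne, funext h]
  simp

theorem derivOne_one (lam : Hyp n ℓ → ℂ) : derivOne lam (1 : GroupRing n ℓ) = 0 := by
  rw [MonoidAlgebra.one_def, derivOne_single]; simp

theorem derivOne_gen (lam : Hyp n ℓ → ℂ) (h : Hyp n ℓ) :
    derivOne lam (MonoidAlgebra.single (gen h) 1) = lam h := by
  rw [derivOne_single, logCharacter_gen]

theorem evalRing_one_single (γ : DiscrGroup n ℓ) :
    evalRing 1 (MonoidAlgebra.single γ 1 : GroupRing n ℓ) = 1 := by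
  rw [← expPoint_zero, evalRing_expPoint_single]; simp

/-- The Magnus matrix of a pure braid over `R`: the Fox Jacobian of its action on `G_j`. -/
noncomputable def jacobian (j : Fin n) (hj : ℓ ≤ (j : ℕ)) (γ : PureBraid n) :
    Matrix (Below j) (Below j) (GroupRing n ℓ) :=
  Matrix.of fun i k => fibreRing j hj (fox k ((artin j γ).unop (FreeGroup.of i)))

theorem evalRing_fibreRing_artin (t : Hyp n ℓ → ℂˣ) (j : Fin n) (hj : ℓ ≤ (j : ℕ))
    (γ : PureBraid n) (x : MonoidAlgebra ℤ (FreeGroup (Below j))) :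
    evalRing t (fibreRing j hj
      (MonoidAlgebra.mapDomainRingHom ℤ (artin j γ).unop.toMonoidHom x)) =
      evalRing t (fibreRing j hj x) := by
  have key : ((evalRing t).comp ((fibreRing j hj).comp (MonoidAlgebra.mapDomainRingHom ℤ
        (artin j γ).unop.toMonoidHom))).toAddMonoidHom =
      ((evalRing t).comp (fibreRing j hj)).toAddMonoidHom := by
    refine addHom_ext_single fun w => ?_
    change evalRing t (fibreRing j hj (MonoidAlgebra.mapDomainRingHom ℤ _ _)) =
      evalRing t (fibreRing j hj _)
    rw [mapDomainRingHom_single, mapDomainRingHom_single, mapDomainRingHom_single, evalRing_single,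
      evalRing_single]
    congr 1
    change ambientCharacter t (fibre j hj ((artin j γ).unop w) : PureBraid n) = _
    rw [fibre_artin, map_mul, map_mul, map_inv, inv_mul_cancel_comm]
  exact DFunLike.congr_fun key x

theorem jacobian_mul (t : Hyp n ℓ → ℂˣ) (j : Fin n) (hj : ℓ ≤ (j : ℕ)) (x y : PureBraid n) :
    (jacobian j hj (x * y)).map (evalRing t) =
      (jacobian j hj x).map (evalRing t) * (jacobian j hj y).map (evalRing t) := by
  refine Matrix.ext fun i k => ?_
  rw [Matrix.mul_apply]
  simp only [jacobian, Matrix.of_apply, Matrix.map_apply]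
  rw [artin_mul_apply]
  have := fox_map k (artin j y).unop.toMonoidHom ((artin j x).unop (FreeGroup.of i))
  rw [show (artin j y).unop ((artin j x).unop (FreeGroup.of i)) =
    (artin j y).unop.toMonoidHom ((artin j x).unop (FreeGroup.of i)) from rfl, this,
    map_sum (MonoidAlgebra.mapDomainRingHom ℤ (fibre j hj)), map_sum]
  refine Finset.sum_congr rfl fun l _ => ?_
  rw [map_mul (MonoidAlgebra.mapDomainRingHom ℤ _), map_mul, evalRing_fibreRing_artin]
  rfl

theorem jacobian_one (j : Fin n) (hj : ℓ ≤ (j : ℕ)) : jacobian j hj (1 : PureBraid n) = 1 := by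
  refine Matrix.ext fun i k => ?_
  simp [jacobian, Matrix.one_apply, fox_of, apply_ite (fibreRing j hj)]

theorem fox_conj {X : Type*} [DecidableEq X] (k : X) (z w : FreeGroup X) :
    fox k (z * w * z⁻¹) = (1 - MonoidAlgebra.single (z * w * z⁻¹) 1) * fox k z +
      MonoidAlgebra.single z 1 * fox k w := by
  rw [fox_mul, fox_mul, fox_inv, mul_neg, ← mul_assoc (MonoidAlgebra.single (z * w) 1),
    ← single_mul, sub_mul, one_mul]
  abel

theorem fibreRing_fox_conj (j : Fin n) (hj : ℓ ≤ (j : ℕ)) (k : Below j)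
    (z w : FreeGroup (Below j)) : fibreRing (ℓ := ℓ) j hj (fox k (z * w * z⁻¹)) =
      (1 - MonoidAlgebra.single (fibre j hj (z * w * z⁻¹)) 1) * fibreRing j hj (fox k z) +
        MonoidAlgebra.single (fibre j hj z) 1 * fibreRing j hj (fox k w) := by
  rw [fox_conj, map_add, map_mul, map_sub, map_one, map_mul, mapDomainRingHom_single,
    mapDomainRingHom_single]

theorem artin_of_lt (j : Fin n) (p : Pair n) (h : p.1.2 < j) (i : Below j) :
    (artin j (PresentedGroup.of p)).unop (FreeGroup.of i) =
      conjugator FreeGroup.of (⟨p.1.1, p.2.trans h⟩ : Below j) ⟨p.1.2, h⟩ i * FreeGroup.of i *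
        (conjugator FreeGroup.of (⟨p.1.1, p.2.trans h⟩ : Below j) ⟨p.1.2, h⟩ i)⁻¹ := by
  rw [artin_of, dif_pos h]
  exact artinHom_of _ _ _

theorem jacobian_of_not_lt (j : Fin n) (hj : ℓ ≤ (j : ℕ)) (p : Pair n) (h : ¬ p.1.2 < j) :
    jacobian j hj (PresentedGroup.of p) = 1 := by
  rw [← jacobian_one j hj]
  simp only [jacobian, artin_of, dif_neg h, map_one]

/-- The Magnus matrices are unipotent at the trivial character: pure braids act trivially on the
abelianization of `G_j`. -/
theorem jacobian_at_one (j : Fin n) (hj : ℓ ≤ (j : ℕ)) (γ : PureBraid n) :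
    (jacobian j hj γ).map (evalRing (1 : Hyp n ℓ → ℂˣ)) = 1 := by
  have h1 : (jacobian j hj (1 : PureBraid n)).map (evalRing (1 : Hyp n ℓ → ℂˣ)) = 1 := by
    rw [jacobian_one, Matrix.map_one _ (map_zero _) (map_one _)]
  induction γ using pureBraid_induction with
  | of p =>
    by_cases h : p.1.2 < j
    · refine Matrix.ext fun i k => ?_
      simp only [jacobian, Matrix.map_apply, Matrix.of_apply]
      rw [artin_of_lt j p h, fibreRing_fox_conj, map_add, map_mul, map_sub, map_one,
        evalRing_one_single, sub_self, zero_mul, zero_add, map_mul, evalRing_one_single, one_mul,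
        fox_of, Matrix.one_apply]
      split_ifs <;> simp
    · rw [jacobian_of_not_lt j hj p h, ← jacobian_one j hj, h1]
  | one => exact h1
  | mul x y hx hy => rw [jacobian_mul, hx, hy, one_mul]
  | inv x hx =>
    have := jacobian_mul (1 : Hyp n ℓ → ℂˣ) j hj x⁻¹ x
    rwa [inv_mul_cancel, h1, hx, mul_one, eq_comm] at this

theorem evalRing_jacobian_at_one (j : Fin n) (hj : ℓ ≤ (j : ℕ)) (γ : PureBraid n) (i k : Below j) :
    evalRing (1 : Hyp n ℓ → ℂˣ) (jacobian j hj γ i k) = if i = k then 1 else 0 := by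
  rw [← Matrix.map_apply (f := evalRing (1 : Hyp n ℓ → ℂˣ)), jacobian_at_one, Matrix.one_apply]

/-- The derivatives of the Magnus matrices at the trivial character depend additively on the braid,
since these matrices are unipotent there. -/
theorem derivOne_jacobian_mul (lam : Hyp n ℓ → ℂ) (j : Fin n) (hj : ℓ ≤ (j : ℕ))
    (x y : PureBraid n) (i k : Below j) :
    derivOne lam (jacobian j hj (x * y) i k) =
      derivOne lam (jacobian j hj x i k) + derivOne lam (jacobian j hj y i k) := by
  have h : ∀ s : ℂ, evalRing (expPoint (s • lam)) (jacobian j hj (x * y) i k) =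
      evalRing (expPoint (s • lam)) (∑ l, jacobian j hj x i l * jacobian j hj y l k) := fun s => by
    rw [← Matrix.map_apply (f := evalRing _), jacobian_mul, Matrix.mul_apply, map_sum]
    exact Finset.sum_congr rfl fun l _ => by
      rw [map_mul, Matrix.map_apply, Matrix.map_apply]
  rw [derivOne, funext h]
  change derivOne lam _ = _
  rw [derivOne_sum]
  simp [derivOne_mul, evalRing_jacobian_at_one, Finset.sum_add_distrib]

/-- The derivative at the trivial character of an entry of `ρ_j`, as a homomorphism of `P_n`. -/
noncomputable def derivRho (lam : Hyp n ℓ → ℂ) (j : Fin n) (hj : ℓ ≤ (j : ℕ)) (i k : Below j) :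
    PureBraid n →* Multiplicative ℂ :=
  MonoidHom.mk' (fun γ => Multiplicative.ofAdd
    ((if i = k then (logCharacter lam (retract j γ)).toAdd else 0) +
      derivOne lam (jacobian j hj γ i k))) fun x y => by
    rw [← ofAdd_add, derivOne_jacobian_mul]
    congr 1
    split_ifs
    · rw [map_mul, map_mul, toAdd_mul]; ring
    · ring

theorem derivRho_apply (lam : Hyp n ℓ → ℂ) (j : Fin n) (hj : ℓ ≤ (j : ℕ)) (i k : Below j)
    (γ : PureBraid n) : (derivRho lam j hj i k γ).toAdd =
      (if i = k then (logCharacter lam (retract j γ)).toAdd else 0) +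
        derivOne lam (jacobian j hj γ i k) := rfl

theorem derivOne_rho (lam : Hyp n ℓ → ℂ) (j : Fin n) (hj : ℓ ≤ (j : ℕ)) (i k : Below j)
    (γ : DiscrGroup n ℓ) : derivOne lam (rho j hj γ i k) = (derivRho lam j hj i k γ).toAdd := by
  have e : rho j hj γ i k =
      MonoidAlgebra.single (retractDiscr j hj γ) 1 * jacobian j hj γ i k := rfl
  rw [e, derivOne_mul, evalRing_one_single, one_mul, evalRing_jacobian_at_one, derivOne_single,
    derivRho_apply]
  have e' : ((retractDiscr j hj γ : DiscrGroup n ℓ) : PureBraid n) = retract j γ := rfl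
  rw [e', mul_ite, mul_one, mul_zero]

/-- The first order part of `ρ_j(x)` only depends on the first order part of `x`. -/
theorem derivOne_rhoRing (lam : Hyp n ℓ → ℂ) (j : Fin n) (hj : ℓ ≤ (j : ℕ)) (i k : Below j)
    (x : GroupRing n ℓ) : derivOne lam (rhoRing j hj x i k) =
      ∑ h : Hyp n ℓ, derivOne (Pi.single h 1) x * (derivRho lam j hj i k (gen h)).toAdd := by
  have key : (derivOneHom lam).comp ((Matrix.entryAddMonoidHom _ i k).comp (rhoRing j hj)) =
      ∑ h : Hyp n ℓ, (AddMonoidHom.mulRight (derivRho lam j hj i k (gen h)).toAdd).comp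
        (derivOneHom (Pi.single h 1)) := by
    refine addHom_ext_single fun γ => ?_
    simp only [AddMonoidHom.finsetSum_apply, AddMonoidHom.comp_apply, AddMonoidHom.coe_mulRight]
    change derivOne lam (rhoRing j hj (MonoidAlgebra.single γ 1) i k) = ∑ h, derivOne _ _ * _
    rw [rhoRing_single, derivOne_rho, toAdd_hom_eq_sum_hyp]
    refine Finset.sum_congr rfl fun h _ => ?_
    rw [derivOne_single, logCharacter_eq_sum, Finset.sum_eq_single h]
    · simp
    · intro h' _ hh; simp [hh]
    · simp
  have := DFunLike.congr_fun key x
  simp only [AddMonoidHom.finsetSum_apply, AddMonoidHom.comp_apply, AddMonoidHom.coe_mulRight]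
    at this
  exact this

end Derivative

/-! ### The linearized boundary matrices -/

section Linearization

variable {n ℓ : ℕ}

/-- The pair of strands of `h` is `{i, k}`. -/
def Joins (h : Hyp n ℓ) (i k : Fin n) : Prop := h.1 = (i, k) ∨ h.1 = (k, i)

instance (h : Hyp n ℓ) (i k : Fin n) : Decidable (Joins h i k) :=
  inferInstanceAs (Decidable (_ ∨ _))

theorem joins_comm {h : Hyp n ℓ} {i k : Fin n} : Joins h i k ↔ Joins h k i := or_comm

/-- At the trivial character, Fox derivatives are additive. -/
theorem evalRing_one_fox_mul (j : Fin n) (hj : ℓ ≤ (j : ℕ)) (k : Below j)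
    (v w : FreeGroup (Below j)) :
    evalRing (1 : Hyp n ℓ → ℂˣ) (fibreRing j hj (fox k (v * w))) =
      evalRing 1 (fibreRing j hj (fox k v)) + evalRing 1 (fibreRing j hj (fox k w)) := by
  rw [fox_mul, map_add, map_mul, map_add, map_mul, mapDomainRingHom_single, evalRing_one_single,
    one_mul]

theorem evalRing_one_fox_inv (j : Fin n) (hj : ℓ ≤ (j : ℕ)) (k : Below j)
    (v : FreeGroup (Below j)) :
    evalRing (1 : Hyp n ℓ → ℂˣ) (fibreRing j hj (fox k v⁻¹)) =
      -evalRing 1 (fibreRing j hj (fox k v)) := by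
  rw [fox_inv, map_neg, map_mul, map_neg, map_mul, mapDomainRingHom_single, evalRing_one_single,
    one_mul]

theorem evalRing_one_fox_of (j : Fin n) (hj : ℓ ≤ (j : ℕ)) (k i : Below j) :
    evalRing (1 : Hyp n ℓ → ℂˣ) (fibreRing j hj (fox k (FreeGroup.of i))) =
      if i = k then 1 else 0 := by
  rw [fox_of]; split_ifs <;> simp

theorem derivOne_fibreRing_conj (lam : Hyp n ℓ → ℂ) (j : Fin n) (hj : ℓ ≤ (j : ℕ)) (i k : Below j)
    (z : FreeGroup (Below j)) :
    derivOne lam (fibreRing j hj (fox k (z * FreeGroup.of i * z⁻¹))) =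
      -lam ⟨(i.1, j), i.2, hj⟩ * evalRing 1 (fibreRing j hj (fox k z)) +
        if i = k then (logCharacter lam (fibre j hj z : PureBraid n)).toAdd else 0 := by
  have h0 : derivOne lam (fibreRing j hj (fox k (FreeGroup.of i))) = 0 := by
    rw [fox_of]; split_ifs <;> simp [derivOne_one, derivOne_zero]
  have h1 : (logCharacter lam (fibre j hj (FreeGroup.of i) : PureBraid n)).toAdd =
      lam ⟨(i.1, j), i.2, hj⟩ := by
    simp [fibre, logCharacter_gen]
  rw [fibreRing_fox_conj, derivOne_add, derivOne_mul, derivOne_mul, h0, derivOne_sub, derivOne_one,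
    derivOne_single, derivOne_single, map_sub, map_one, evalRing_one_single, evalRing_one_fox_of]
  simp [h1]

theorem derivRho_gen (lam : Hyp n ℓ → ℂ) (j : Fin n) (hj : ℓ ≤ (j : ℕ)) (i k : Below j)
    (h : Hyp n ℓ) : (derivRho lam j hj i k (gen h)).toAdd =
      (if i = k then (if h.1.2 < j then lam h else 0) +
          ∑ a : Below j, (if Joins h a k then lam ⟨(a.1, j), a.2, hj⟩ else 0) else 0) -
        if Joins h i k then lam ⟨(i.1, j), i.2, hj⟩ else 0 := by
  have hg : (gen h : PureBraid n) = PresentedGroup.of ⟨h.1, h.2.1⟩ := rfl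
  rw [derivRho_apply, hg, retract_of]
  by_cases hh : h.1.2 < j
  · let r : Below j := ⟨h.1.1, h.2.1.trans hh⟩
    let s : Below j := ⟨h.1.2, hh⟩
    have hrs : r < s := h.2.1
    have hJ : ∀ a b : Below j, Joins h a b ↔ (r = a ∧ s = b) ∨ (r = b ∧ s = a) := fun a b => by
      simp only [Joins, Prod.ext_iff, Subtype.ext_iff, r, s]
    have hlog : ∀ a : Below j, (logCharacter lam (fibre j hj (FreeGroup.of a) : PureBraid n)).toAdd =
        lam ⟨(a.1, j), a.2, hj⟩ := fun a => by
      simp [fibre, logCharacter_gen]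
    have hjac : derivOne lam (jacobian j hj (PresentedGroup.of ⟨h.1, h.2.1⟩) i k) =
        derivOne lam (fibreRing j hj (fox k (conjugator FreeGroup.of r s i * FreeGroup.of i *
          (conjugator FreeGroup.of r s i)⁻¹))) := by
      rw [jacobian, Matrix.of_apply, artin_of_lt j ⟨h.1, h.2.1⟩ hh]
    rw [if_pos hh, if_pos hh, ← hg, logCharacter_gen, hg, hjac, derivOne_fibreRing_conj]
    simp only [hJ]
    have hsum : ∀ f : Below j → ℂ, (∑ a : Below j, if (r = a ∧ s = k) ∨ (r = k ∧ s = a) then f a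
        else 0) = if k = r then f s else if k = s then f r else 0 := fun f => by
      split_ifs with h1 h2
      · subst h1
        rw [Finset.sum_eq_single s]
        · simp
        · intro b _ hb; simp [hrs.ne', hb.symm]
        · simp
      · subst h2
        rw [Finset.sum_eq_single r]
        · simp
        · intro b _ hb; simp [hrs.ne, hb.symm]
        · simp
      · exact Finset.sum_eq_zero fun a _ => if_neg (by
          rintro (⟨-, h⟩ | ⟨h, -⟩)
          · exact h2 h.symm
          · exact h1 h.symm)
    rw [hsum fun a => lam ⟨(a.1, j), a.2, hj⟩]
    by_cases hi : i = r ∨ i = s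
    · have hz : conjugator FreeGroup.of r s i = FreeGroup.of r * FreeGroup.of s := if_pos hi
      rw [hz, evalRing_one_fox_mul, evalRing_one_fox_of, evalRing_one_fox_of, map_mul,
        Subgroup.coe_mul, map_mul, toAdd_mul, hlog, hlog]
      rcases hi with rfl | rfl
      · by_cases h1 : k = r
        · simp [h1, hrs.ne, hrs.ne']
        · by_cases h2 : k = s
          · simp [h2, hrs.ne, hrs.ne']
          · simp [h1, Ne.symm h1, h2, Ne.symm h2]
      · by_cases h1 : k = s
        · simp [h1, hrs.ne, hrs.ne']
        · by_cases h2 : k = r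
          · simp [h2, hrs.ne, hrs.ne']
          · simp [h1, Ne.symm h1, h2, Ne.symm h2]
    · -- the conjugator is trivial in the abelianization
      have hz : evalRing (1 : Hyp n ℓ → ℂˣ)
            (fibreRing j hj (fox k (conjugator FreeGroup.of r s i))) = 0 ∧
          (logCharacter lam (fibre j hj (conjugator FreeGroup.of r s i) : PureBraid n)).toAdd = 0 := by
        rw [conjugator, if_neg hi]
        split_ifs
        · simp only [evalRing_one_fox_mul, evalRing_one_fox_inv, map_mul, map_inv, Subgroup.coe_mul,
            Subgroup.coe_inv, toAdd_mul, toAdd_inv]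
          constructor <;> ring
        · simp [fox_one]
      rw [hz.1, hz.2]
      push Not at hi
      by_cases h1 : i = k
      · subst h1
        simp [hi.1, hi.2, hi.1.symm, hi.2.symm]
      · simp [hi.1.symm, hi.2.symm, h1]
  · have hJ : ∀ a b : Below j, ¬ Joins h a b := by
      rintro a b (e | e)
      · exact hh (e ▸ b.2)
      · exact hh (e ▸ a.2)
    simp only [hJ, if_neg hh, jacobian_of_not_lt j hj ⟨h.1, h.2.1⟩ hh, Matrix.one_apply, if_false,
      Finset.sum_const_zero]
    split_ifs <;> simp [derivOne_one, derivOne_zero]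

theorem derivOne_boundaryMatrix_zero (lam : Hyp n ℓ → ℂ) (r : Idx n ℓ 1) (c : Idx n ℓ 0) :
    derivOne lam (boundaryMatrix n ℓ 0 r c) = lam r.last := by
  rw [boundaryMatrix_zero, derivOne_sub, derivOne_gen, derivOne_one, sub_zero]

theorem derivOne_boundaryMatrix_succ (lam : Hyp n ℓ → ℂ) (q : ℕ) (r : Idx n ℓ (q + 2))
    (c : Idx n ℓ (q + 1)) :
    derivOne lam (boundaryMatrix n ℓ (q + 1) r c) =
      -(if h : c.last.1.2 = r.last.1.2 then
        ∑ p : Hyp n ℓ, derivOne (Pi.single p 1) (boundaryMatrix n ℓ q r.init c.init) *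
          (derivRho lam r.last.1.2 r.last.2.2 ⟨r.last.1.1, r.last.2.1⟩
            ⟨c.last.1.1, h ▸ c.last.2.1⟩ (gen p)).toAdd else 0) +
        if c = r.init then lam r.last else 0 := by
  rw [boundaryMatrix_succ, derivOne_add, derivOne_neg]
  congr 2
  · rw [rhoEntry]
    split_ifs
    · rw [derivOne_rhoRing]
    · rw [derivOne_zero]
  · split_ifs
    · rw [derivOne_sub, derivOne_gen, derivOne_one, sub_zero]
    · rw [derivOne_zero]

end Linearization

/-! ### A module over the Orlik–Solomon algebra -/

section Model

variable {n ℓ : ℕ}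

/-- The vector space with basis the lists of generators. The list `[h_q, …, h_1]` stands for the
product `a_{h_1} ⋯ a_{h_q}`, so that prepending `c` is right multiplication by `a_c`. -/
abbrev Word (n ℓ : ℕ) : Type := List (Hyp n ℓ) →₀ ℂ

namespace Word

/-- Prepending a letter to all lists. -/
noncomputable def cons (c : Hyp n ℓ) : Word n ℓ →ₗ[ℂ] Word n ℓ := Finsupp.lmapDomain ℂ ℂ (List.cons c)

/-- Multiplication by `(-1)^q` on the lists of length `q`. -/
noncomputable def sgn : Word n ℓ →ₗ[ℂ] Word n ℓ :=
  Finsupp.linearCombination ℂ fun b => Finsupp.single b ((-1) ^ b.length)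

/-- Left multiplication by `a_h`, rewritten in terms of the monomials: it commutes with right
multiplication by `a_c` if the second strand `j` of `h` is less than that of `c`; it is `±` right
multiplication if `j` is larger; and if `c = (k, j)` and `h = (i, j)`, then it is given by
`a_{i,j} x a_{k,j} = (a_{i,k} x) (a_{k,j} - a_{i,j})`. -/
noncomputable def lmulList : List (Hyp n ℓ) → Hyp n ℓ → Word n ℓ
  | [], h => Finsupp.single [h] 1
  | c :: b, h =>
    if h.1.2 < c.1.2 then cons c (lmulList b h)
    else if h.1.2 = c.1.2 then
      ∑ p : Hyp n ℓ, if Joins p h.1.1 c.1.1 then cons c (lmulList b p) - cons h (lmulList b p) else 0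
    else cons h (sgn (cons c (Finsupp.single b 1)))

/-- The operator of left multiplication by `a_h`. -/
noncomputable def lmul (h : Hyp n ℓ) : Word n ℓ →ₗ[ℂ] Word n ℓ :=
  Finsupp.linearCombination ℂ fun b => lmulList b h

/-- The operator of left multiplication by `a_{i,k}`, for any two strands in any order; it is `0` if
there is no such generator. -/
noncomputable def lmulPair (i k : Fin n) : Word n ℓ →ₗ[ℂ] Word n ℓ :=
  ∑ p : Hyp n ℓ, if Joins p i k then lmul p else 0

theorem cons_single (c : Hyp n ℓ) (b : List (Hyp n ℓ)) (z : ℂ) :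
    cons c (Finsupp.single b z) = Finsupp.single (c :: b) z := by
  simp [cons]

theorem lmul_single (h : Hyp n ℓ) (b : List (Hyp n ℓ)) :
    lmul h (Finsupp.single b 1) = lmulList b h := by
  simp [lmul]

theorem sgn_single (b : List (Hyp n ℓ)) (z : ℂ) :
    sgn (Finsupp.single b z) = Finsupp.single b ((-1) ^ b.length * z) := by
  simp [sgn, mul_comm]

theorem lmul_nil (h : Hyp n ℓ) :
    lmul h (Finsupp.single [] 1) = cons h (Finsupp.single [] 1) := by
  rw [lmul_single, lmulList, cons_single]

theorem sgn_nil : sgn (Finsupp.single [] 1 : Word n ℓ) = Finsupp.single [] 1 := by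
  simp [sgn_single]

theorem lmulPair_apply (i k : Fin n) (x : Word n ℓ) :
    lmulPair i k x = ∑ p : Hyp n ℓ, if Joins p i k then lmul p x else 0 := by
  rw [lmulPair, LinearMap.sum_apply]
  exact Finset.sum_congr rfl fun p _ => by split_ifs <;> rfl

theorem linearMap_ext {M : Type*} [AddCommMonoid M] [Module ℂ M] {f g : Word n ℓ →ₗ[ℂ] M}
    (h : ∀ b, f (Finsupp.single b 1) = g (Finsupp.single b 1)) : f = g :=
  Finsupp.lhom_ext fun b z => by
    rw [← mul_one z, ← smul_eq_mul, ← Finsupp.smul_single, map_smul, map_smul, h]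

theorem sgn_cons (c : Hyp n ℓ) (x : Word n ℓ) : sgn (cons c x) = -cons c (sgn x) := by
  have : (sgn ∘ₗ cons c : Word n ℓ →ₗ[ℂ] Word n ℓ) = -(cons c ∘ₗ sgn) :=
    linearMap_ext fun b => by simp [cons_single, sgn_single, pow_succ]
  exact DFunLike.congr_fun this x

theorem lmul_cons_lt {h c : Hyp n ℓ} (hc : h.1.2 < c.1.2) (x : Word n ℓ) :
    lmul h (cons c x) = cons c (lmul h x) := by
  have : (lmul h ∘ₗ cons c : Word n ℓ →ₗ[ℂ] Word n ℓ) = cons c ∘ₗ lmul h :=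
    linearMap_ext fun b => by
      simp only [LinearMap.comp_apply, cons_single, lmul_single, lmulList, if_pos hc]
  exact DFunLike.congr_fun this x

theorem lmul_cons_eq {h c : Hyp n ℓ} (hc : h.1.2 = c.1.2) (x : Word n ℓ) :
    lmul h (cons c x) =
      cons c (lmulPair h.1.1 c.1.1 x) - cons h (lmulPair h.1.1 c.1.1 x) := by
  have : (lmul h ∘ₗ cons c : Word n ℓ →ₗ[ℂ] Word n ℓ) = (cons c - cons h) ∘ₗ lmulPair h.1.1 c.1.1 :=
    linearMap_ext fun b => by
      simp only [LinearMap.comp_apply, cons_single, lmul_single, lmulList,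
        if_neg (not_lt_of_ge hc.ge), if_pos hc, lmulPair_apply, map_sum, LinearMap.sub_apply]
      exact Finset.sum_congr rfl fun p _ => by split_ifs <;> simp
  exact DFunLike.congr_fun this x

theorem lmul_cons_gt {h c : Hyp n ℓ} (hc : c.1.2 < h.1.2) (x : Word n ℓ) :
    lmul h (cons c x) = cons h (sgn (cons c x)) := by
  have : (lmul h ∘ₗ cons c : Word n ℓ →ₗ[ℂ] Word n ℓ) = cons h ∘ₗ sgn ∘ₗ cons c :=
    linearMap_ext fun b => by
      simp only [LinearMap.comp_apply, cons_single, lmul_single, lmulList,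
        if_neg (not_lt_of_ge hc.le), if_neg hc.ne']
  exact DFunLike.congr_fun this x

theorem lmulPair_comm (i k : Fin n) : (lmulPair i k : Word n ℓ →ₗ[ℂ] Word n ℓ) = lmulPair k i := by
  simp only [lmulPair, joins_comm]

theorem lmulPair_self (i : Fin n) : (lmulPair i i : Word n ℓ →ₗ[ℂ] Word n ℓ) = 0 :=
  Finset.sum_eq_zero fun p _ => if_neg (by
    rintro (h | h) <;>
    · have := p.2.1
      rw [h] at this
      exact lt_irrefl _ this)

theorem lmulPair_of_lt {i k : Fin n} (hik : i < k) (hk : ℓ ≤ (k : ℕ)) :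
    (lmulPair i k : Word n ℓ →ₗ[ℂ] Word n ℓ) = lmul ⟨(i, k), hik, hk⟩ := by
  rw [lmulPair, Finset.sum_eq_single ⟨(i, k), hik, hk⟩]
  · exact if_pos (Or.inl rfl)
  · intro p _ hp
    refine if_neg ?_
    rintro (h | h)
    · exact hp (Subtype.ext h)
    · have := p.2.1
      rw [h] at this
      exact lt_asymm this hik
  · simp

theorem lmulPair_eq_zero {i k : Fin n} (hi : (i : ℕ) < ℓ) (hk : (k : ℕ) < ℓ) :
    (lmulPair i k : Word n ℓ →ₗ[ℂ] Word n ℓ) = 0 :=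
  Finset.sum_eq_zero fun p _ => if_neg (by
    rintro (h | h) <;>
    · have := p.2.2
      rw [h] at this
      exact absurd this (by simpa))

theorem lmulPair_cons {i k : Fin n} {c : Hyp n ℓ} (hi : i < c.1.2) (hk : k < c.1.2) (x : Word n ℓ) :
    lmulPair i k (cons c x) = cons c (lmulPair i k x) := by
  rw [lmulPair_apply, lmulPair_apply, map_sum]
  refine Finset.sum_congr rfl fun p _ => ?_
  split_ifs with h
  · refine lmul_cons_lt ?_ x
    rcases h with h | h <;> rw [h]
    exacts [hk, hi]
  · simp

theorem sgn_lmul (h : Hyp n ℓ) (x : Word n ℓ) : sgn (lmul h x) = -lmul h (sgn x) := by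
  have : ∀ (b : List (Hyp n ℓ)) (h : Hyp n ℓ),
      sgn (lmul h (Finsupp.single b 1)) = -lmul h (sgn (Finsupp.single b 1)) := by
    intro b
    induction b with
    | nil => intro h; rw [lmul_nil, sgn_nil, lmul_nil, sgn_cons, sgn_nil]
    | cons c b ih =>
      intro h
      rw [← cons_single, sgn_cons, map_neg, neg_neg]
      rcases lt_trichotomy h.1.2 c.1.2 with hc | hc | hc
      · rw [lmul_cons_lt hc, lmul_cons_lt hc, sgn_cons, ih, map_neg, neg_neg]
      · have hT : sgn (lmulPair h.1.1 c.1.1 (Finsupp.single b 1)) =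
            -lmulPair h.1.1 c.1.1 (sgn (Finsupp.single b 1)) := by
          rw [lmulPair_apply, lmulPair_apply, map_sum, ← Finset.sum_neg_distrib]
          refine Finset.sum_congr rfl fun p _ => ?_
          split_ifs
          · exact ih p
          · simp
        rw [lmul_cons_eq hc, lmul_cons_eq hc, map_sub, sgn_cons, sgn_cons, hT]
        simp only [map_neg, neg_neg]
      · rw [lmul_cons_gt hc, lmul_cons_gt hc, sgn_cons h, sgn_cons c]
        simp only [map_neg, neg_neg]
  have : (sgn ∘ₗ lmul h : Word n ℓ →ₗ[ℂ] Word n ℓ) = -(lmul h ∘ₗ sgn) :=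
    linearMap_ext fun b => this b h
  exact DFunLike.congr_fun this x

/-- The operators of left multiplication anticommute at `x`. -/
def Anticommutes (x : Word n ℓ) : Prop := ∀ h h' : Hyp n ℓ, lmul h (lmul h' x) = -lmul h' (lmul h x)

/-- The three-term Orlik–Solomon relations hold at `x`; those with strands `i, j` both among the first
`ℓ` strands are included, with `lmulPair i j = 0`. -/
def ThreeTerm (x : Word n ℓ) : Prop := ∀ i j k : Fin n, i < j → j < k →
  lmulPair i j (lmulPair i k x) - lmulPair i j (lmulPair j k x) + lmulPair i k (lmulPair j k x) = 0

theorem Anticommutes.lmul_lmulPair {x : Word n ℓ} (hx : Anticommutes x) (h : Hyp n ℓ) (i j : Fin n) :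
    lmul h (lmulPair i j x) = -lmulPair i j (lmul h x) := by
  rw [lmulPair_apply, lmulPair_apply, map_sum, ← Finset.sum_neg_distrib]
  refine Finset.sum_congr rfl fun p _ => ?_
  split_ifs
  · exact hx h p
  · simp

theorem Anticommutes.lmulPair_lmulPair {x : Word n ℓ} (hx : Anticommutes x) (i j k l : Fin n) :
    lmulPair i j (lmulPair k l x) = -lmulPair k l (lmulPair i j x) := by
  rw [lmulPair_apply i j, lmulPair_apply i j, map_sum, ← Finset.sum_neg_distrib]
  refine Finset.sum_congr rfl fun p _ => ?_
  split_ifs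
  · rw [hx.lmul_lmulPair]
  · simp

/-- In view of anticommutativity, the three-term relations hold for strands in any order. -/
theorem ThreeTerm.all {x : Word n ℓ} (hx : ThreeTerm x) (ha : Anticommutes x) (i j k : Fin n) :
    lmulPair i j (lmulPair i k x) - lmulPair i j (lmulPair j k x) + lmulPair i k (lmulPair j k x) =
      0 := by
  have hsq : ∀ a b : Fin n, lmulPair a b (lmulPair a b x) = 0 := fun a b =>
    self_eq_neg.mp (ha.lmulPair_lmulPair a b a b)
  -- the left hand side is alternating in `i`, `j`, `k`
  have swap1 : ∀ a b c : Fin n,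
      lmulPair a b (lmulPair a c x) - lmulPair a b (lmulPair b c x) +
        lmulPair a c (lmulPair b c x) = 0 →
      lmulPair b a (lmulPair b c x) - lmulPair b a (lmulPair a c x) +
        lmulPair b c (lmulPair a c x) = 0 := fun a b c h => by
    rw [lmulPair_comm b a, ha.lmulPair_lmulPair b c a c, ← neg_eq_zero, ← h]
    abel
  have swap2 : ∀ a b c : Fin n,
      lmulPair a b (lmulPair a c x) - lmulPair a b (lmulPair b c x) +
        lmulPair a c (lmulPair b c x) = 0 →
      lmulPair a c (lmulPair a b x) - lmulPair a c (lmulPair c b x) +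
        lmulPair a b (lmulPair c b x) = 0 := fun a b c h => by
    rw [lmulPair_comm c b, ha.lmulPair_lmulPair a c a b, ← neg_eq_zero, ← h]
    abel
  rcases lt_trichotomy i j with hij | rfl | hij
  · rcases lt_trichotomy j k with hjk | rfl | hjk
    · exact hx i j k hij hjk
    · simp [hsq, lmulPair_self]
    · rcases lt_trichotomy i k with hik | rfl | hik
      · exact swap2 _ _ _ (hx i k j hik hjk)
      · simp [hsq, lmulPair_self, lmulPair_comm j i]
      · exact swap2 _ _ _ (swap1 _ _ _ (hx k i j hik hij))
  · simp [hsq, lmulPair_self]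
  · rcases lt_trichotomy i k with hik | rfl | hik
    · exact swap1 _ _ _ (hx j i k hij hik)
    · simp [hsq, lmulPair_self, lmulPair_comm j i]
    · rcases lt_trichotomy j k with hjk | rfl | hjk
      · exact swap1 _ _ _ (swap2 _ _ _ (hx j k i hjk hik))
      · simp [hsq, lmulPair_self]
      · exact swap1 _ _ _ (swap2 _ _ _ (swap1 _ _ _ (hx k j i hjk hij)))

theorem threeTerm_of_top {x : Word n ℓ} {i j k : Fin n} (hij : i < j) (hjk : j < k)
    (hk : ℓ ≤ (k : ℕ)) (y : Word n ℓ)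
    (h1 : lmul ⟨(i, k), hij.trans hjk, hk⟩ x = cons ⟨(i, k), hij.trans hjk, hk⟩ y)
    (h2 : lmul ⟨(j, k), hjk, hk⟩ x = cons ⟨(j, k), hjk, hk⟩ y) :
    lmulPair i j (lmulPair i k x) - lmulPair i j (lmulPair j k x) + lmulPair i k (lmulPair j k x) =
      0 := by
  rw [lmulPair_of_lt (hij.trans hjk) hk, lmulPair_of_lt hjk hk, h1, h2,
    lmulPair_cons (hij.trans hjk) hjk, lmulPair_cons (hij.trans hjk) hjk, lmul_cons_eq (by rfl)]
  abel

theorem lmul_lmul_cons_top {h h' c : Hyp n ℓ} (hh : h.1.2 < h'.1.2) (hc : c.1.2 < h'.1.2)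
    (x : Word n ℓ) :
    lmul h' (lmul h (cons c x)) = cons h' (sgn (lmul h (cons c x))) := by
  rcases lt_trichotomy h.1.2 c.1.2 with h1 | h1 | h1
  · rw [lmul_cons_lt h1, lmul_cons_gt hc]
  · rw [lmul_cons_eq h1, map_sub, lmul_cons_gt hc, lmul_cons_gt hh, map_sub, map_sub]
  · rw [lmul_cons_gt h1, lmul_cons_gt hh]

/-- The defining relations of the Orlik–Solomon algebra hold for the operators of left
multiplication. -/
theorem relations (b : List (Hyp n ℓ)) :
    Anticommutes (Finsupp.single b 1 : Word n ℓ) ∧ ThreeTerm (Finsupp.single b 1 : Word n ℓ) := by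
  induction b with
  | nil =>
    constructor
    · -- by symmetry, the second strand of `h` may be assumed to be at most that of `h'`
      have key : ∀ h h' : Hyp n ℓ, h.1.2 ≤ h'.1.2 → lmul h (lmul h' (Finsupp.single [] 1)) =
          -lmul h' (lmul h (Finsupp.single [] 1)) := fun h h' hh => by
        rw [lmul_nil, lmul_nil]
        rcases hh.lt_or_eq with hh | hh
        · rw [lmul_cons_lt hh, lmul_cons_gt hh, sgn_cons, sgn_nil, lmul_nil, map_neg, neg_neg]
        · rw [lmul_cons_eq hh, lmul_cons_eq hh.symm, lmulPair_comm h.1.1]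
          abel
      intro h h'
      rcases le_total h.1.2 h'.1.2 with hh | hh
      · exact key h h' hh
      · rw [key h' h hh, neg_neg]
    · intro i j k hij hjk
      by_cases hk : (k : ℕ) < ℓ
      · rw [lmulPair_eq_zero (lt_trans (Fin.lt_def.mp (hij.trans hjk)) hk) hk,
          lmulPair_eq_zero (lt_trans (Fin.lt_def.mp hjk) hk) hk]
        simp
      · exact threeTerm_of_top hij hjk (not_lt.mp hk) _ (lmul_nil _) (lmul_nil _)
  | cons c b ih =>
    obtain ⟨ha, ht⟩ := ih
    rw [← cons_single]
    set v : Word n ℓ := Finsupp.single b 1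
    constructor
    · have key : ∀ h h' : Hyp n ℓ, h.1.2 ≤ h'.1.2 →
          lmul h (lmul h' (cons c v)) = -lmul h' (lmul h (cons c v)) := fun h h' hh => by
        rcases lt_trichotomy h'.1.2 c.1.2 with h1 | h1 | h1
        · rw [lmul_cons_lt h1, lmul_cons_lt (hh.trans_lt h1), lmul_cons_lt (hh.trans_lt h1),
            lmul_cons_lt h1, ha h h', map_neg]
        · rcases hh.lt_or_eq with hh | hh
          · have h2 : h.1.2 < c.1.2 := h1 ▸ hh
            rw [lmul_cons_eq h1, lmul_cons_lt h2, lmul_cons_eq h1, map_sub, lmul_cons_lt h2,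
              lmul_cons_lt hh, ha.lmul_lmulPair, map_neg, map_neg]
            abel
          · have h2 : h.1.2 = c.1.2 := hh.trans h1
            rw [lmul_cons_eq h1, lmul_cons_eq h2, map_sub, map_sub, lmul_cons_eq h1,
              lmul_cons_eq h2, lmul_cons_eq hh, lmul_cons_eq hh.symm, lmulPair_comm h'.1.1 h.1.1,
              ha.lmulPair_lmulPair h'.1.1 c.1.1 h.1.1 c.1.1]
            have hr := ht.all ha h.1.1 h'.1.1 c.1.1
            have e : lmulPair h.1.1 c.1.1 (lmulPair h'.1.1 c.1.1 v) =
                lmulPair h.1.1 h'.1.1 (lmulPair h'.1.1 c.1.1 v) -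
                  lmulPair h.1.1 h'.1.1 (lmulPair h.1.1 c.1.1 v) := by
              rw [← sub_eq_zero, ← hr]; abel
            rw [e]
            simp only [map_neg, map_sub]
            abel
        · rcases hh.lt_or_eq with hh | hh
          · rw [lmul_lmul_cons_top hh h1, lmul_cons_gt h1, lmul_cons_lt hh, sgn_lmul, map_neg,
              neg_neg]
          · rw [lmul_cons_gt h1, lmul_cons_gt (h1.trans_eq hh.symm), lmul_cons_eq hh, lmul_cons_eq hh.symm,
              lmulPair_comm h.1.1]
            abel
      intro h h'
      rcases le_total h.1.2 h'.1.2 with hh | hh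
      · exact key h h' hh
      · rw [key h' h hh, neg_neg]
    · intro i j k hij hjk
      by_cases hk : (k : ℕ) < ℓ
      · rw [lmulPair_eq_zero (lt_trans (Fin.lt_def.mp (hij.trans hjk)) hk) hk,
          lmulPair_eq_zero (lt_trans (Fin.lt_def.mp hjk) hk) hk]
        simp
      · have hik := hij.trans hjk
        rcases lt_trichotomy k c.1.2 with h1 | rfl | h1
        · have h2 := hjk.trans h1
          have h3 := hij.trans h2
          rw [lmulPair_cons h3 h1, lmulPair_cons h2 h1, lmulPair_cons h3 h2, lmulPair_cons h3 h2,
            lmulPair_cons h3 h1, ← map_sub, ← map_add, ht i j k hij hjk, map_zero]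
        · have hcons : ∀ c' : Hyp n ℓ, c'.1.2 = c.1.2 → ∀ x : Word n ℓ,
              lmulPair i j (cons c' x) = cons c' (lmulPair i j x) := fun c' h x =>
            lmulPair_cons (hik.trans_eq h.symm) (hjk.trans_eq h.symm) x
          rw [lmulPair_of_lt hik (not_lt.mp hk), lmulPair_of_lt hjk (not_lt.mp hk),
            lmul_cons_eq (by rfl), lmul_cons_eq (by rfl), map_sub, map_sub, map_sub,
            hcons c rfl, hcons c rfl, hcons ⟨(i, c.1.2), hik, not_lt.mp hk⟩ rfl,
            hcons ⟨(j, c.1.2), hjk, not_lt.mp hk⟩ rfl, lmul_cons_eq (by rfl),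
            lmul_cons_eq (by rfl)]
          dsimp only
          have hr := ht.all ha i j c.1.1
          have e : lmulPair i c.1.1 (lmulPair j c.1.1 v) =
              lmulPair i j (lmulPair j c.1.1 v) - lmulPair i j (lmulPair i c.1.1 v) := by
            rw [← sub_eq_zero, ← hr]; abel
          simp only [e, map_sub]
          abel
        · exact threeTerm_of_top hij hjk (not_lt.mp hk) _ (lmul_cons_gt h1 v) (lmul_cons_gt h1 v)

theorem anticommutes (x : Word n ℓ) : Anticommutes x := fun h h' => by
  have : (lmul h ∘ₗ lmul h' : Word n ℓ →ₗ[ℂ] Word n ℓ) = -(lmul h' ∘ₗ lmul h) :=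
    linearMap_ext fun b => (relations b).1 h h'
  exact DFunLike.congr_fun this x

theorem threeTerm (x : Word n ℓ) : ThreeTerm x := fun i j k hij hjk => by
  have : (lmulPair i j ∘ₗ lmulPair i k - lmulPair i j ∘ₗ lmulPair j k +
      lmulPair i k ∘ₗ lmulPair j k : Word n ℓ →ₗ[ℂ] Word n ℓ) = 0 :=
    linearMap_ext fun b => (relations b).2 i j k hij hjk
  exact DFunLike.congr_fun this x

end Word

end Model

/-! ### The monomial basis of the Orlik–Solomon algebra -/

section Basis

variable {n ℓ : ℕ}

open Word

theorem osGen_mul_self (h : Hyp n ℓ) : osGen h * osGen h = 0 := by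
  rw [osGen, ← map_mul, extGen, ExteriorAlgebra.ι_sq_zero, map_zero]

theorem osGen_mul_comm (h h' : Hyp n ℓ) : osGen h * osGen h' = -(osGen h' * osGen h) := by
  have := ExteriorAlgebra.ι_add_mul_swap (R := ℂ) (Pi.single h 1 : Hyp n ℓ → ℂ) (Pi.single h' 1)
  rw [← sub_eq_zero, sub_neg_eq_add, osGen, osGen, ← map_mul, ← map_mul, ← map_add, extGen, extGen,
    this, map_zero]

theorem osGen_triple {i j k : Fin n} (hij : i < j) (hjk : j < k) (hj : ℓ ≤ (j : ℕ))
    (hk : ℓ ≤ (k : ℕ)) :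
    osGen ⟨(i, j), hij, hj⟩ * osGen ⟨(i, k), hij.trans hjk, hk⟩ -
          osGen ⟨(i, j), hij, hj⟩ * osGen ⟨(j, k), hjk, hk⟩ +
          osGen ⟨(i, k), hij.trans hjk, hk⟩ * osGen ⟨(j, k), hjk, hk⟩ = 0 := by
  have := RingQuot.mkAlgHom_rel ℂ (OSRel.triple i j k hij hjk hj hk)
  simp only [map_add, map_sub, map_mul, map_zero] at this
  exact this

theorem osGen_parallel {i j k : Fin n} (hij : i < j) (hjk : j < k) (hj : (j : ℕ) < ℓ)
    (hk : ℓ ≤ (k : ℕ)) :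
    osGen ⟨(i, k), hij.trans hjk, hk⟩ * osGen ⟨(j, k), hjk, hk⟩ = 0 := by
  have := RingQuot.mkAlgHom_rel ℂ (OSRel.parallel i j k hij hjk hj hk)
  simp only [map_mul, map_zero] at this
  exact this

/-- The generator `a_{i,k}`, for any two strands in any order, or `0` if there is none. -/
noncomputable def osPair (i k : Fin n) : OSAlgebra n ℓ :=
  ∑ p : Hyp n ℓ, if Joins p i k then osGen p else 0

theorem osPair_comm (i k : Fin n) : (osPair i k : OSAlgebra n ℓ) = osPair k i := by
  simp only [osPair, joins_comm]

theorem osPair_of_lt {i k : Fin n} (hik : i < k) (hk : ℓ ≤ (k : ℕ)) :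
    osPair i k = osGen (⟨(i, k), hik, hk⟩ : Hyp n ℓ) := by
  rw [osPair, Finset.sum_eq_single ⟨(i, k), hik, hk⟩]
  · exact if_pos (Or.inl rfl)
  · intro p _ hp
    refine if_neg ?_
    rintro (h | h)
    · exact hp (Subtype.ext h)
    · have := p.2.1
      rw [h] at this
      exact lt_asymm this hik
  · simp

theorem osPair_eq_zero {i k : Fin n} (hi : (i : ℕ) < ℓ) (hk : (k : ℕ) < ℓ) :
    (osPair i k : OSAlgebra n ℓ) = 0 :=
  Finset.sum_eq_zero fun p _ => if_neg (by
    rintro (h | h) <;>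
    · have := p.2.2
      rw [h] at this
      exact absurd this (by simpa))

/-- The Orlik–Solomon relations as a rule for rewriting products of two generators with the same
second strand. -/
theorem osGen_mul_osGen {h c : Hyp n ℓ} (hc : h.1.2 = c.1.2) :
    osGen h * osGen c = osPair h.1.1 c.1.1 * (osGen c - osGen h) := by
  obtain ⟨⟨i, m⟩, him, hm⟩ := h
  obtain ⟨⟨k, m'⟩, hkm, hm'⟩ := c
  obtain rfl : m = m' := hc
  dsimp only at *
  have key : ∀ {i k : Fin n} (hik : i < k) (hkm : k < m),
      osGen (⟨(i, m), hik.trans hkm, hm⟩ : Hyp n ℓ) * osGen ⟨(k, m), hkm, hm⟩ =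
        osPair i k * (osGen ⟨(k, m), hkm, hm⟩ - osGen ⟨(i, m), hik.trans hkm, hm⟩) := by
    intro i k hik hkm
    by_cases hk : ℓ ≤ (k : ℕ)
    · rw [osPair_of_lt hik hk, ← sub_eq_zero, ← osGen_triple hik hkm hk hm, mul_sub]
      abel
    · have hk := not_le.mp hk
      rw [osPair_eq_zero (lt_trans (Fin.lt_def.mp hik) hk) hk, zero_mul,
        osGen_parallel hik hkm hk hm]
  rcases lt_trichotomy i k with hik | rfl | hik
  · exact key hik hkm
  · rw [osGen_mul_self, sub_self, mul_zero]
  · rw [osGen_mul_comm, key hik him, osPair_comm, ← mul_neg, neg_sub]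

/-- The element of the Orlik–Solomon algebra that is represented by a linear combination of lists. -/
noncomputable def Word.toOS : Word n ℓ →ₗ[ℂ] OSAlgebra n ℓ :=
  Finsupp.linearCombination ℂ fun b => (b.reverse.map osGen).prod

theorem toOS_single (b : List (Hyp n ℓ)) :
    toOS (Finsupp.single b 1) = (b.reverse.map osGen).prod := by
  simp [toOS]

theorem toOS_cons (c : Hyp n ℓ) (x : Word n ℓ) : toOS (cons c x) = toOS x * osGen c := by
  have : (toOS ∘ₗ cons c : Word n ℓ →ₗ[ℂ] OSAlgebra n ℓ) = LinearMap.mulRight ℂ (osGen c) ∘ₗ toOS :=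
    linearMap_ext fun b => by
      simp [cons_single, toOS_single]
  exact DFunLike.congr_fun this x

theorem osGen_mul_toOS (h : Hyp n ℓ) (x : Word n ℓ) : osGen h * toOS x = toOS (sgn x) * osGen h := by
  have key : ∀ b : List (Hyp n ℓ), osGen h * toOS (Finsupp.single b 1) =
      toOS (sgn (Finsupp.single b 1)) * osGen h := by
    intro b
    induction b with
    | nil => rw [sgn_nil, toOS_single]; simp
    | cons c b ih =>
      rw [← cons_single, toOS_cons, ← mul_assoc, ih, sgn_cons, map_neg, toOS_cons, mul_assoc,
        osGen_mul_comm h c, mul_neg, neg_mul, mul_assoc]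
  have : (LinearMap.mulLeft ℂ (osGen h) ∘ₗ toOS : Word n ℓ →ₗ[ℂ] OSAlgebra n ℓ) =
      LinearMap.mulRight ℂ (osGen h) ∘ₗ toOS ∘ₗ sgn := linearMap_ext key
  exact DFunLike.congr_fun this x

/-- The operator `lmul h` represents left multiplication by `a_h`. -/
theorem toOS_lmul (h : Hyp n ℓ) (x : Word n ℓ) : toOS (lmul h x) = osGen h * toOS x := by
  have key : ∀ (b : List (Hyp n ℓ)) (h : Hyp n ℓ),
      toOS (lmul h (Finsupp.single b 1)) = osGen h * toOS (Finsupp.single b 1) := by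
    intro b
    induction b with
    | nil => intro h; rw [lmul_nil, toOS_cons, toOS_single]; simp
    | cons c b ih =>
      intro h
      rw [← cons_single]
      rcases lt_trichotomy h.1.2 c.1.2 with hc | hc | hc
      · rw [lmul_cons_lt hc, toOS_cons, ih, toOS_cons, mul_assoc]
      · have hT : toOS (lmulPair h.1.1 c.1.1 (Finsupp.single b 1)) =
            toOS (sgn (Finsupp.single b 1)) * osPair h.1.1 c.1.1 := by
          rw [lmulPair_apply, osPair, map_sum, Finset.mul_sum]
          refine Finset.sum_congr rfl fun p _ => ?_
          split_ifs
          · rw [ih, osGen_mul_toOS]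
          · simp
        rw [lmul_cons_eq hc, map_sub, toOS_cons, toOS_cons, hT, ← mul_sub, mul_assoc,
          ← osGen_mul_osGen hc, toOS_cons, ← mul_assoc, ← mul_assoc, osGen_mul_toOS]
      · rw [lmul_cons_gt hc, toOS_cons, osGen_mul_toOS]
  have : (toOS ∘ₗ lmul h : Word n ℓ →ₗ[ℂ] OSAlgebra n ℓ) = LinearMap.mulLeft ℂ (osGen h) ∘ₗ toOS :=
    linearMap_ext fun b => key b h
  exact DFunLike.congr_fun this x

/-- Left multiplication by `∑ v_h a_h`. -/
noncomputable def lmulSum : (Hyp n ℓ → ℂ) →ₗ[ℂ] Module.End ℂ (Word n ℓ) :=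
  Fintype.linearCombination ℂ lmul

theorem lmulSum_apply (v : Hyp n ℓ → ℂ) (x : Word n ℓ) : lmulSum v x = ∑ h, v h • lmul h x := by
  simp [lmulSum, Fintype.linearCombination_apply, LinearMap.sum_apply]

theorem lmulSum_single (h : Hyp n ℓ) : lmulSum (Pi.single h 1) = (lmul h : Word n ℓ →ₗ[ℂ] _) := by
  simp [lmulSum, Fintype.linearCombination_apply_single]

theorem lmulSum_mul_self (v : Hyp n ℓ → ℂ) : lmulSum v * lmulSum v = 0 := by
  refine LinearMap.ext fun x => ?_
  have e : lmulSum v (lmulSum v x) = ∑ h, ∑ h', (v h * v h') • lmul h (lmul h' x) := by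
    rw [lmulSum_apply]
    simp only [lmulSum_apply, map_sum, map_smul, Finset.smul_sum, smul_smul]
  refine self_eq_neg.mp (?_ : lmulSum v (lmulSum v x) = -lmulSum v (lmulSum v x))
  conv_rhs => rw [e, Finset.sum_comm]
  rw [e, ← Finset.sum_neg_distrib]
  refine Finset.sum_congr rfl fun h _ => ?_
  rw [← Finset.sum_neg_distrib]
  refine Finset.sum_congr rfl fun h' _ => ?_
  rw [anticommutes x h h', smul_neg, mul_comm]

/-- The action of the Orlik–Solomon algebra on words, with `a_h` acting as `lmul h`. -/
noncomputable def osAct : OSAlgebra n ℓ →ₐ[ℂ] Module.End ℂ (Word n ℓ) :=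
  RingQuot.liftAlgHom ℂ ⟨ExteriorAlgebra.lift ℂ ⟨lmulSum, lmulSum_mul_self⟩, by
    have e : ∀ h : Hyp n ℓ, ExteriorAlgebra.lift ℂ ⟨lmulSum, lmulSum_mul_self⟩ (extGen h) =
        (lmul h : Word n ℓ →ₗ[ℂ] _) := fun h => by
      rw [extGen, ExteriorAlgebra.lift_ι_apply, lmulSum_single]
    intro x y hxy
    cases hxy with
    | triple i j k hij hjk hj hk =>
      simp only [map_add, map_sub, map_mul, map_zero, e]
      refine LinearMap.ext fun x => ?_
      have := threeTerm x i j k hij hjk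
      rwa [lmulPair_of_lt hij hj, lmulPair_of_lt hjk hk, lmulPair_of_lt (hij.trans hjk) hk] at this
    | parallel i j k hij hjk hj hk =>
      simp only [map_mul, map_zero, e]
      refine LinearMap.ext fun x => ?_
      have := threeTerm x i j k hij hjk
      rwa [lmulPair_eq_zero (lt_trans (Fin.lt_def.mp hij) hj) hj, lmulPair_of_lt hjk hk,
        lmulPair_of_lt (hij.trans hjk) hk, LinearMap.zero_apply, LinearMap.zero_apply, sub_zero,
        zero_add] at this⟩

theorem osAct_ι (v : Hyp n ℓ → ℂ) : osAct (osMk n ℓ (ExteriorAlgebra.ι ℂ v)) = lmulSum v := by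
  rw [osAct, osMk, RingQuot.liftAlgHom_mkAlgHom_apply]
  exact ExteriorAlgebra.lift_ι_apply _ _ _ _

theorem osAct_osGen (h : Hyp n ℓ) : osAct (osGen h) = (lmul h : Word n ℓ →ₗ[ℂ] _) := by
  rw [osGen, extGen, osAct_ι, lmulSum_single]

theorem osMk_ι (v : Hyp n ℓ → ℂ) : osMk n ℓ (ExteriorAlgebra.ι ℂ v) = omega v := by
  have : v = ∑ h, v h • (Pi.single h 1 : Hyp n ℓ → ℂ) := by
    funext h; simp [Finset.sum_apply, Pi.single_apply]
  conv_lhs => rw [this]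
  simp only [map_sum, map_smul]
  rfl

theorem osAct_omega (v : Hyp n ℓ → ℂ) : osAct (omega v) = lmulSum v := by
  rw [← osMk_ι, osAct_ι]

theorem omega_mul_self (v : Hyp n ℓ → ℂ) : omega v * omega v = 0 := by
  rw [← osMk_ι, ← map_mul, ExteriorAlgebra.ι_sq_zero, map_zero]

theorem toOS_osAct (a : OSAlgebra n ℓ) (x : Word n ℓ) : toOS (osAct a x) = a * toOS x := by
  obtain ⟨y, rfl⟩ := RingQuot.mkAlgHom_surjective ℂ (OSRel n ℓ) a
  change toOS (osAct (osMk n ℓ y) x) = osMk n ℓ y * toOS x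
  induction y using ExteriorAlgebra.induction generalizing x with
  | algebraMap r =>
    rw [AlgHom.commutes, AlgHom.commutes, Module.algebraMap_end_apply, map_smul, Algebra.smul_def]
  | ι v =>
    rw [osAct_ι, lmulSum_apply, map_sum, osMk_ι, omega, Finset.sum_mul]
    exact Finset.sum_congr rfl fun h _ => by rw [map_smul, toOS_lmul, smul_mul_assoc]
  | mul y z hy hz => rw [map_mul, map_mul, Module.End.mul_apply, hy, hz, mul_assoc]
  | add y z hy hz => rw [map_add, map_add, LinearMap.add_apply, map_add, hy, hz, add_mul]

/-- The expansion of an element of the Orlik–Solomon algebra in terms of monomials. -/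
noncomputable def expand : OSAlgebra n ℓ →ₗ[ℂ] Word n ℓ :=
  LinearMap.applyₗ (Finsupp.single [] 1) ∘ₗ osAct.toLinearMap

theorem expand_apply (a : OSAlgebra n ℓ) : expand a = osAct a (Finsupp.single [] 1) := rfl

theorem toOS_expand (a : OSAlgebra n ℓ) : toOS (expand a) = a := by
  rw [expand_apply, toOS_osAct, toOS_single]; simp

theorem lmul_single_of_lt (h : Hyp n ℓ) (b : List (Hyp n ℓ)) (hb : ∀ c ∈ b, h.1.2 < c.1.2) :
    lmul h (Finsupp.single b 1) = (Finsupp.single (b ++ [h]) 1 : Word n ℓ) := by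
  induction b with
  | nil => rw [lmul_nil, cons_single]; rfl
  | cons c b ih =>
    rw [← cons_single, lmul_cons_lt (hb c (by simp)), ih fun c' hc' => hb c' (by simp [hc']),
      cons_single]
    rfl

theorem expand_prod (b : List (Hyp n ℓ)) (hb : b.Pairwise fun h h' => h.1.2 < h'.1.2) :
    expand (b.map osGen).prod = Finsupp.single b.reverse 1 := by
  induction b with
  | nil => simp [expand_apply]
  | cons h b ih =>
    rw [List.pairwise_cons] at hb
    rw [List.map_cons, List.prod_cons, expand_apply, map_mul, Module.End.mul_apply, ← expand_apply,
      ih hb.2, osAct_osGen, lmul_single_of_lt, List.reverse_cons]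
    intro c hc
    exact hb.1 c (by simpa using hc)

/-- The list of the pairs `(i_p, j_p)`, in decreasing order of `j_p`. -/
def Idx.toList {q : ℕ} (b : Idx n ℓ q) : List (Hyp n ℓ) := (List.ofFn b.1).reverse

theorem Idx.toList_zero (b : Idx n ℓ 0) : b.toList = [] := by simp [Idx.toList]

theorem Idx.toList_succ {q : ℕ} (b : Idx n ℓ (q + 1)) : b.toList = b.last :: b.init.toList := by
  rw [Idx.toList, List.ofFn_succ', List.concat_eq_append, List.reverse_append]
  rfl

theorem Idx.toList_injective {q : ℕ} : Function.Injective (Idx.toList : Idx n ℓ q → _) :=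
  fun _ _ h => Subtype.ext (List.ofFn_injective (List.reverse_injective h))

theorem expand_monomial {q : ℕ} (b : Idx n ℓ q) :
    expand (monomial b : OSAlgebra n ℓ) = Finsupp.single b.toList 1 := by
  have : (monomial b : OSAlgebra n ℓ) = ((List.ofFn b.1).map osGen).prod := by
    rw [List.map_ofFn]; rfl
  rw [this, expand_prod, Idx.toList]
  rw [List.pairwise_ofFn]
  exact fun i j hij => b.2 hij

/-- The span of the monomials `a_{I,J}` of degree `q` with all strands less than `m`. -/
noncomputable def sortedSpan (n ℓ q m : ℕ) : Submodule ℂ (Word n ℓ) :=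
  Submodule.span ℂ {x | ∃ b : Idx n ℓ q, (∀ s, ((b.1 s).1.2 : ℕ) < m) ∧ Finsupp.single b.toList 1 = x}

theorem cons_mem_sortedSpan {q m m' : ℕ} {c : Hyp n ℓ} (hm : m ≤ c.1.2) (hm' : (c.1.2 : ℕ) < m')
    {x : Word n ℓ} (hx : x ∈ sortedSpan n ℓ q m) : cons c x ∈ sortedSpan n ℓ (q + 1) m' := by
  induction hx using Submodule.span_induction with
  | mem x hx =>
    obtain ⟨b, hb, rfl⟩ := hx
    have hlt : ∀ s, (b.1 s).1.2 < c.1.2 := fun s => Fin.lt_def.mpr ((hb s).trans_le hm)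
    refine Submodule.subset_span ⟨b.snoc c hlt, fun s => ?_, ?_⟩
    · refine lt_of_le_of_lt (Fin.le_def.mp ((b.snoc c hlt).le_last s)) ?_
      rwa [Idx.last_snoc]
    · rw [Idx.toList_succ, Idx.last_snoc, Idx.init_snoc, cons_single]
  | zero => rw [map_zero]; exact Submodule.zero_mem _
  | add x y _ _ hx hy => rw [map_add]; exact Submodule.add_mem _ hx hy
  | smul z x _ hx => rw [map_smul]; exact Submodule.smul_mem _ _ hx

theorem lmul_single_mem_sortedSpan {q m : ℕ} (b : Idx n ℓ q) (hb : ∀ s, ((b.1 s).1.2 : ℕ) < m)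
    (h : Hyp n ℓ) (hh : (h.1.2 : ℕ) < m) :
    lmul h (Finsupp.single b.toList 1) ∈ sortedSpan n ℓ (q + 1) m := by
  induction q generalizing h m with
  | zero =>
    rw [Idx.toList_zero, lmul_nil]
    exact cons_mem_sortedSpan (m := 0) (Nat.zero_le _) hh
      (Submodule.subset_span ⟨b, fun s => s.elim0, by rw [Idx.toList_zero]⟩)
  | succ q ih =>
    have hlast : (b.last.1.2 : ℕ) < m := hb _
    have hinit : ∀ s, ((b.init.1 s).1.2 : ℕ) < b.last.1.2 := fun s =>
      Fin.lt_def.mp (b.init_lt_last s)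
    rw [Idx.toList_succ, ← cons_single]
    rcases lt_trichotomy h.1.2 b.last.1.2 with hc | hc | hc
    · rw [lmul_cons_lt hc]
      exact cons_mem_sortedSpan le_rfl hlast (ih b.init hinit h hc)
    · have hT : lmulPair h.1.1 b.last.1.1 (Finsupp.single b.init.toList 1) ∈
          sortedSpan n ℓ (q + 1) b.last.1.2 := by
        rw [lmulPair_apply]
        refine Submodule.sum_mem _ fun p _ => ?_
        split_ifs with hp
        · refine ih b.init hinit p (Fin.lt_def.mp ?_)
          rcases hp with hp | hp <;> rw [hp]
          exacts [b.last.2.1, hc ▸ h.2.1]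
        · exact Submodule.zero_mem _
      rw [lmul_cons_eq hc]
      exact Submodule.sub_mem _ (cons_mem_sortedSpan le_rfl hlast hT)
        (cons_mem_sortedSpan hc.ge hh hT)
    · rw [lmul_cons_gt hc, cons_single, sgn_single, ← smul_eq_mul, ← Finsupp.smul_single,
        ← Idx.toList_succ]
      refine cons_mem_sortedSpan (m := h.1.2) le_rfl hh
        (Submodule.smul_mem _ _ (Submodule.subset_span ⟨b, fun s => ?_, rfl⟩))
      exact Fin.lt_def.mp ((b.le_last s).trans_lt hc)

theorem lmulSum_mem_sortedSpan {q : ℕ} (v : Hyp n ℓ → ℂ) {x : Word n ℓ}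
    (hx : x ∈ sortedSpan n ℓ q n) : lmulSum v x ∈ sortedSpan n ℓ (q + 1) n := by
  rw [lmulSum_apply]
  refine Submodule.sum_mem _ fun h _ => Submodule.smul_mem _ _ ?_
  induction hx using Submodule.span_induction with
  | mem x hx =>
    obtain ⟨b, hb, rfl⟩ := hx
    exact lmul_single_mem_sortedSpan b hb h h.1.2.2
  | zero => rw [map_zero]; exact Submodule.zero_mem _
  | add x y _ _ hx hy => rw [map_add]; exact Submodule.add_mem _ hx hy
  | smul z x _ hx => rw [map_smul]; exact Submodule.smul_mem _ _ hx

theorem expand_mem_sortedSpan {q : ℕ} (x : OSDeg n ℓ q) :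
    expand (x : OSAlgebra n ℓ) ∈ sortedSpan n ℓ q n := by
  obtain ⟨x, y, hy, rfl⟩ := x
  change osAct (osMk n ℓ y) (Finsupp.single [] 1) ∈ _
  induction q generalizing y with
  | zero =>
    replace hy : y ∈ LinearMap.range (ExteriorAlgebra.ι ℂ (M := Hyp n ℓ → ℂ)) ^ 0 := hy
    rw [pow_zero] at hy
    obtain ⟨z, rfl⟩ := Submodule.mem_one.mp hy
    rw [AlgHom.commutes, AlgHom.commutes, Module.algebraMap_end_apply]
    refine Submodule.smul_mem _ _ (Submodule.subset_span
      ⟨⟨fun s => s.elim0, fun s => s.elim0⟩, fun s => s.elim0, ?_⟩)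
    rw [Idx.toList_zero]
  | succ q ih =>
    replace hy : y ∈ LinearMap.range (ExteriorAlgebra.ι ℂ (M := Hyp n ℓ → ℂ)) ^ (q + 1) := hy
    rw [pow_succ'] at hy
    induction hy using Submodule.mul_induction_on' with
    | mem_mul_mem a ha b hb =>
      obtain ⟨v, rfl⟩ := ha
      rw [map_mul, map_mul, Module.End.mul_apply, osAct_ι]
      exact lmulSum_mem_sortedSpan v (ih b hb)
    | add a _ b _ ha hb =>
      rw [map_add, map_add, LinearMap.add_apply]
      exact Submodule.add_mem _ ha hb

theorem sortedSpan_eq_zero {q m : ℕ} {x : Word n ℓ} (hx : x ∈ sortedSpan n ℓ q m)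
    (h0 : ∀ b : Idx n ℓ q, x b.toList = 0) : x = 0 := by
  have hsupp : sortedSpan n ℓ q m ≤ Finsupp.supported ℂ ℂ (Set.range (Idx.toList (q := q))) := by
    refine Submodule.span_le.mpr ?_
    rintro _ ⟨b, _, rfl⟩
    exact Finsupp.single_mem_supported ℂ _ ⟨b, rfl⟩
  ext l
  by_cases hl : l ∈ Set.range (Idx.toList (n := n) (ℓ := ℓ) (q := q))
  · obtain ⟨b, rfl⟩ := hl
    exact h0 b
  · by_contra h
    exact hl ((Finsupp.mem_supported ℂ x).mp (hsupp hx) (Finsupp.mem_support_iff.mpr h))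

/-- The coordinates of an element of `A^q` with respect to the monomials `a_{I,J}`. -/
noncomputable def osCoord (n ℓ q : ℕ) : OSDeg n ℓ q →ₗ[ℂ] (Idx n ℓ q → ℂ) :=
  LinearMap.pi fun b => Finsupp.lapply b.toList ∘ₗ expand ∘ₗ (OSDeg n ℓ q).subtype

theorem osCoord_apply {q : ℕ} (x : OSDeg n ℓ q) (b : Idx n ℓ q) :
    osCoord n ℓ q x b = expand (x : OSAlgebra n ℓ) b.toList := rfl

theorem osCoord_monomial {q : ℕ} (b : Idx n ℓ q) : osCoord n ℓ q (monomial b) = Pi.single b 1 := by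
  funext c
  rw [osCoord_apply, expand_monomial, Finsupp.single_apply, Pi.single_apply]
  simp only [Idx.toList_injective.eq_iff, eq_comm]

/-- The monomials `a_{I,J}` form a basis of `A^q`. -/
theorem osCoord_bijective (n ℓ q : ℕ) : Function.Bijective (osCoord n ℓ q) := by
  constructor
  · rw [← LinearMap.ker_eq_bot, LinearMap.ker_eq_bot']
    intro x hx
    have := sortedSpan_eq_zero (expand_mem_sortedSpan x) fun b => congrFun hx b
    apply Subtype.ext
    rw [← toOS_expand (x : OSAlgebra n ℓ), this, map_zero]
    rfl
  · rw [← LinearMap.range_eq_top, eq_top_iff]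
    intro f _
    have : f = ∑ b, f b • osCoord n ℓ q (monomial b) := by
      funext c
      simp [osCoord_monomial, Finset.sum_apply, Pi.single_apply]
    rw [this]
    exact Submodule.sum_mem _ fun b _ => Submodule.smul_mem _ _ ⟨_, rfl⟩

end Basis

/-! ### Comparison of the two complexes -/

section Comparison

variable {n ℓ : ℕ}

open Word

theorem cons_apply (c d : Hyp n ℓ) (x : Word n ℓ) (l : List (Hyp n ℓ)) :
    cons c x (d :: l) = if d = c then x l else 0 := by
  have : (Finsupp.lapply (d :: l) ∘ₗ cons c : Word n ℓ →ₗ[ℂ] ℂ) =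
      if d = c then Finsupp.lapply l else 0 := linearMap_ext fun b => by
    simp only [LinearMap.comp_apply, cons_single, Finsupp.lapply_apply]
    split_ifs with h
    · simp [h, Finsupp.single_apply]
    · simp [Finsupp.single_apply, Ne.symm h]
  have := DFunLike.congr_fun this x
  rw [LinearMap.comp_apply, Finsupp.lapply_apply] at this
  rw [this]
  split_ifs <;> rfl

theorem sum_hyp_eq (m : Fin n) (hm : ℓ ≤ (m : ℕ)) (f : Hyp n ℓ → ℂ) :
    (∑ h : Hyp n ℓ, if h.1.2 = m then f h else 0) = ∑ a : Below m, f ⟨(a.1, m), a.2, hm⟩ := by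
  symm
  refine Fintype.sum_of_injective (fun a : Below m => (⟨(a.1, m), a.2, hm⟩ : Hyp n ℓ)) ?_ _ _ ?_ ?_
  · intro a a' e
    exact Subtype.ext (congrArg (fun h : Hyp n ℓ => h.1.1) e)
  · intro h hh
    refine if_neg ?_
    rintro rfl
    exact hh ⟨⟨h.1.1, h.2.1⟩, rfl⟩
  · intro a
    exact (if_pos rfl).symm

/-- In the coordinates given by the monomials and the standard basis, left multiplication by
`ω_λ` is, up to sign, the derivative of the boundary matrix. -/
theorem lmulSum_toList (lam : Hyp n ℓ → ℂ) (q : ℕ) (b : Idx n ℓ (q + 1)) (c : Idx n ℓ q) :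
    lmulSum lam (Finsupp.single c.toList 1) b.toList =
      (-1) ^ q * derivOne lam (boundaryMatrix n ℓ q b c) := by
  induction q generalizing lam with
  | zero =>
    rw [lmulSum_apply, derivOne_boundaryMatrix_zero, Finsupp.finsetSum_apply, c.toList_zero,
      b.toList_succ]
    simp only [lmul_nil, Finsupp.smul_apply, cons_apply, b.init.toList_zero]
    simp
  | succ q ih =>
    -- coefficients of the generators one degree lower
    have hX : ∀ p : Hyp n ℓ, derivOne (Pi.single p 1) (boundaryMatrix n ℓ q b.init c.init) =
        (-1) ^ q * lmul p (Finsupp.single c.init.toList 1) b.init.toList := fun p => by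
      rw [← lmulSum_single, ih, ← mul_assoc, ← mul_pow]
      simp
    rw [derivOne_boundaryMatrix_succ, lmulSum_apply, Finsupp.finsetSum_apply, c.toList_succ,
      b.toList_succ, ← cons_single]
    simp only [hX, Finsupp.smul_apply, smul_eq_mul]
    set v : Word n ℓ := Finsupp.single c.init.toList 1
    set l := b.init.toList
    by_cases hj : c.last.1.2 = b.last.1.2
    · have hne : c ≠ b.init := by
        rintro rfl
        exact (b.init_lt_last (Fin.last q)).ne hj
      have hterm : ∀ h : Hyp n ℓ, lmul h (cons c.last v) (b.last :: l) =
          (if b.last = c.last then (if h.1.2 < b.last.1.2 then lmul h v l else 0) +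
            (if h.1.2 = b.last.1.2 then lmulPair h.1.1 c.last.1.1 v l else 0) else 0) -
            if b.last = h then lmulPair b.last.1.1 c.last.1.1 v l else 0 := fun h => by
        rcases lt_trichotomy h.1.2 c.last.1.2 with h1 | h1 | h1
        · have h2 : h.1.2 < b.last.1.2 := h1.trans_eq hj
          have h3 : b.last ≠ h := by rintro rfl; exact lt_irrefl _ h2
          rw [lmul_cons_lt h1, cons_apply, if_pos h2, if_neg h2.ne, if_neg h3, add_zero, sub_zero]
        · have h2 : h.1.2 = b.last.1.2 := h1.trans hj
          rw [lmul_cons_eq h1, Finsupp.sub_apply, cons_apply, cons_apply, if_neg h2.not_lt,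
            if_pos h2, zero_add]
          congr 1
          split_ifs with h3
          · rw [h3]
          · rfl
        · have h2 : b.last.1.2 < h.1.2 := hj.symm.trans_lt h1
          have h3 : b.last ≠ h := by rintro rfl; exact lt_irrefl _ h2
          rw [lmul_cons_gt h1, cons_apply, if_neg h3, if_neg h3, if_neg h2.not_gt, if_neg h2.ne']
          simp
      have hik : ((⟨b.last.1.1, b.last.2.1⟩ : Below b.last.1.2) =
          ⟨c.last.1.1, hj ▸ c.last.2.1⟩) ↔ b.last = c.last :=
        ⟨fun h => Subtype.ext (Prod.ext (congrArg Subtype.val h) hj.symm), fun h => by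
          apply Subtype.ext
          exact congrArg (fun h : Hyp n ℓ => h.1.1) h⟩
      have hY : ∀ i : Fin n, lmulPair i c.last.1.1 v l =
          ∑ p : Hyp n ℓ, if Joins p i c.last.1.1 then lmul p v l else 0 := fun i => by
        rw [lmulPair_apply, Finsupp.finsetSum_apply]
        exact Finset.sum_congr rfl fun p _ => by split_ifs <;> rfl
      have hright : ∀ f : Hyp n ℓ → ℂ, (-1 : ℂ) ^ (q + 1) * (-∑ p, (-1) ^ q * lmul p v l * f p + 0) =
          ∑ p, lmul p v l * f p := fun f => by
        simp only [mul_assoc]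
        rw [← Finset.mul_sum, add_zero, ← neg_mul, ← mul_assoc, pow_succ, mul_neg_one, neg_mul_neg,
          ← mul_pow]
        simp
      rw [dif_pos hj, if_neg hne, hright]
      simp only [derivRho_gen, hik, hterm, hY, mul_sub, Finset.sum_sub_distrib, mul_ite, mul_zero,
        Finset.sum_ite_eq, Finset.mem_univ, if_true]
      congr 1
      · split_ifs
        · simp only [mul_add, Finset.sum_add_distrib, mul_ite, mul_zero]
          congr 1
          · exact Finset.sum_congr rfl fun p _ => by rw [mul_comm]
          · rw [sum_hyp_eq b.last.1.2 b.last.2.2]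
            simp only [Finset.mul_sum]
            rw [Finset.sum_comm]
            refine Finset.sum_congr rfl fun p _ => Finset.sum_congr rfl fun a _ => ?_
            split_ifs
            · rw [mul_comm]
            · simp
        · simp
      · rw [Finset.mul_sum]
        exact Finset.sum_congr rfl fun p _ => by split_ifs <;> ring
    · have hne : b.last ≠ c.last := fun h => hj (by rw [h])
      rw [dif_neg hj, neg_zero, zero_add]
      have hterm : ∀ h : Hyp n ℓ, lmul h (cons c.last v) (b.last :: l) =
          if b.last = h then (if c = b.init then (-1) ^ (q + 1) else 0) else 0 := fun h => by
        by_cases hh : c.last.1.2 < h.1.2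
        · rw [lmul_cons_gt hh, cons_apply, cons_single, ← c.toList_succ, sgn_single,
            Finsupp.single_apply]
          simp only [l, Idx.toList_injective.eq_iff]
          simp [Idx.toList]
        · have h1 : lmul h (cons c.last v) (b.last :: l) = 0 := by
            rcases (not_lt.mp hh).lt_or_eq with h1 | h1
            · rw [lmul_cons_lt h1, cons_apply, if_neg hne]
            · have : b.last ≠ h := by rintro rfl; exact hj h1.symm
              rw [lmul_cons_eq h1, Finsupp.sub_apply, cons_apply, cons_apply, if_neg hne,
                if_neg this, sub_zero]
          rw [h1]
          split_ifs with h2 h3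
          · subst h2
            subst h3
            exact absurd (b.init_lt_last _) hh
          · rfl
          · rfl
      simp only [hterm, mul_ite, mul_zero, Finset.sum_ite_eq, Finset.mem_univ, if_true]
      split_ifs
      · rw [mul_comm]
      · rfl

theorem coboundaryMatrix_eq (q : ℕ) (t : Hyp n ℓ → ℂˣ) :
    coboundaryMatrix q t = (-1 : ℂ) ^ q • boundaryMatrixAt q t := by
  refine Matrix.ext fun a b => ?_
  have h1 : boundary n ℓ q (Pi.single a 1) = boundaryMatrix n ℓ q a := by
    rw [boundary, Matrix.toLinearMapRight'_apply, Matrix.single_one_vecMul]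
    rfl
  have h2 : ∀ (u : Cochain q t) (x : Chain n ℓ q),
      LocalSys.toComplex t (u x) = ∑ c, evalRing t (x c) * coord q t u c := fun u x => by
    conv_lhs => rw [pi_eq_sum_univ' x]
    simp only [map_sum, map_smul, LocalSys.toComplex_smul, coord_apply]
  rw [coboundaryMatrix, LinearMap.toMatrix'_apply]
  change coord (q + 1) t (coboundary q t ((coord q t).symm _)) a = _
  rw [coord_apply]
  change LocalSys.toComplex t ((-1 : ℂ) ^ q • ((coord q t).symm _) (boundary n ℓ q _)) = _
  rw [map_smul, h1, h2]
  simp [boundaryMatrixAt, Pi.single_apply]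

theorem differentiable_boundaryMatrixAt (q : ℕ) (a : Idx n ℓ (q + 1)) (b : Idx n ℓ q) :
    Differentiable ℂ (fun v : Hyp n ℓ → ℂ => boundaryMatrixAt q (expPoint v) a b) :=
  differentiable_evalRing _

theorem derivAtOne_boundaryMatrixAt (lam : Hyp n ℓ → ℂ) (q : ℕ) (a : Idx n ℓ (q + 1))
    (b : Idx n ℓ q) :
    derivAtOne (boundaryMatrixAt q) lam a b = derivOne lam (boundaryMatrix n ℓ q a b) := rfl

theorem derivAtOne_coboundaryMatrix (lam : Hyp n ℓ → ℂ) (q : ℕ) :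
    derivAtOne (coboundaryMatrix q) lam = (-1 : ℂ) ^ q • derivAtOne (boundaryMatrixAt q) lam := by
  refine Matrix.ext fun a b => ?_
  simp only [derivAtOne, Matrix.of_apply, coboundaryMatrix_eq, Matrix.smul_apply, smul_eq_mul]
  exact deriv_const_mul_field _

theorem coboundary_comp (q : ℕ) (t : Hyp n ℓ → ℂˣ) : coboundary (q + 1) t ∘ₗ coboundary q t = 0 := by
  have h : boundary n ℓ q ∘ₗ boundary n ℓ (q + 1) = 0 := by
    rw [boundary, boundary, ← Matrix.toLinearMapRight'_mul, boundaryMatrix_mul, map_zero]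
  refine LinearMap.ext fun u => LinearMap.ext fun x => ?_
  change (-1 : ℂ) ^ (q + 1) • ((-1 : ℂ) ^ q • u (boundary n ℓ q (boundary n ℓ (q + 1) x))) = 0
  rw [← LinearMap.comp_apply (boundary n ℓ q), h, LinearMap.zero_apply, map_zero, smul_zero,
    smul_zero]

/-- The isomorphism `A^q ≅ C^q` matching the monomials with the dual basis. -/
noncomputable def osEquiv (n ℓ q : ℕ) : OSDeg n ℓ q ≃ₗ[ℂ] (Idx n ℓ q → ℂ) :=
  LinearEquiv.ofBijective (osCoord n ℓ q) (osCoord_bijective n ℓ q)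

theorem osEquiv_monomial {q : ℕ} (b : Idx n ℓ q) : osEquiv n ℓ q (monomial b) = Pi.single b 1 :=
  osCoord_monomial b

theorem osEquiv_comp_mu (lam : Hyp n ℓ → ℂ) (q : ℕ) :
    (osEquiv n ℓ (q + 1)).toLinearMap ∘ₗ mu q lam ∘ₗ (osEquiv n ℓ q).symm.toLinearMap =
      Matrix.toLin' (derivAtOne (coboundaryMatrix q) lam) := by
  refine LinearMap.pi_ext' fun c => LinearMap.ext_ring ?_
  funext b
  have h : (osEquiv n ℓ q).symm (Pi.single c 1) = monomial c := by
    rw [LinearEquiv.symm_apply_eq, osEquiv_monomial]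
  simp only [LinearMap.comp_apply, LinearMap.single_apply, LinearEquiv.coe_coe, h]
  rw [Matrix.toLin'_apply, Matrix.mulVec_single_one, Matrix.col_apply, derivAtOne_coboundaryMatrix,
    Matrix.smul_apply, derivAtOne_boundaryMatrixAt, smul_eq_mul, ← lmulSum_toList]
  change expand (omega lam * (monomial c : OSAlgebra n ℓ)) b.toList = _
  rw [expand_apply, map_mul, Module.End.mul_apply, osAct_omega, ← expand_apply, expand_monomial]

theorem mu_comp_mu (lam : Hyp n ℓ → ℂ) (q : ℕ) : mu (q + 1) lam ∘ₗ mu q lam = 0 := by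
  refine LinearMap.ext fun x => Subtype.ext ?_
  change omega lam * (omega lam * (x : OSAlgebra n ℓ)) = 0
  rw [← mul_assoc, omega_mul_self, zero_mul]

end Comparison

end Discr

/-- For all `λ` and `q`: the maps `δ^q(t)` form a complex and depend holomorphically on `t`, their
derivatives `δ^q_*(λ)` at `t = 1` form a complex, and the bijection of the monomials `a_{I,J}` with
the dual basis of `C^q` is a linear isomorphism `A^q ≅ C^q` that identifies `μ^q(λ)` with
`δ^q_*(λ)`, whose matrix is the transpose of that of `(-1)^q (∂_{q+1})_*(λ)`. -/
theorem theorem3p1 (n ℓ : ℕ) (hℓ : 1 ≤ ℓ) (hn : ℓ ≤ n) :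
    (∀ (t : Hyp n ℓ → ℂˣ) (q : ℕ), coboundary (q + 1) t ∘ₗ coboundary q t = 0) ∧
    (∀ (q : ℕ) (a : Idx n ℓ (q + 1)) (b : Idx n ℓ q),
      Differentiable ℂ (fun v : Hyp n ℓ → ℂ => coboundaryMatrix q (expPoint v) a b) ∧
      Differentiable ℂ (fun v : Hyp n ℓ → ℂ => boundaryMatrixAt q (expPoint v) a b)) ∧
    (∀ (lam : Hyp n ℓ → ℂ) (q : ℕ),
      derivAtOne (coboundaryMatrix (q + 1)) lam * derivAtOne (coboundaryMatrix q) lam = 0) ∧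
    ∃ Φ : ∀ q : ℕ, OSDeg n ℓ q ≃ₗ[ℂ] (Idx n ℓ q → ℂ),
      (∀ (q : ℕ) (b : Idx n ℓ q), Φ q (monomial b) = Pi.single b 1) ∧
      ∀ (lam : Hyp n ℓ → ℂ) (q : ℕ),
        (Φ (q + 1)).toLinearMap ∘ₗ mu q lam =
            Matrix.toLin' (derivAtOne (coboundaryMatrix q) lam) ∘ₗ (Φ q).toLinearMap ∧
        LinearMap.toMatrixRight'
            ((Φ (q + 1)).toLinearMap ∘ₗ mu q lam ∘ₗ (Φ q).symm.toLinearMap) =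
          (-1 : ℂ) ^ q • (derivAtOne (boundaryMatrixAt q) lam).transpose := by
  refine ⟨fun t q => coboundary_comp q t, fun q a b => ⟨?_, differentiable_boundaryMatrixAt q a b⟩,
    fun lam q => ?_, osEquiv n ℓ, fun q b => osEquiv_monomial b, fun lam q => ⟨?_, ?_⟩⟩
  · simp only [coboundaryMatrix_eq, Matrix.smul_apply]
    exact (differentiable_boundaryMatrixAt q a b).const_smul ((-1 : ℂ) ^ q)
  · apply Matrix.toLin'.injective
    rw [Matrix.toLin'_mul, ← osEquiv_comp_mu, ← osEquiv_comp_mu, map_zero]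
    refine LinearMap.ext fun x => ?_
    have := DFunLike.congr_fun (mu_comp_mu lam q) ((osEquiv n ℓ q).symm x)
    simp only [LinearMap.comp_apply, LinearEquiv.coe_coe, LinearEquiv.symm_apply_apply] at this ⊢
    rw [this]
    simp
  · rw [← osEquiv_comp_mu]
    refine LinearMap.ext fun x => ?_
    simp
  · rw [osEquiv_comp_mu, derivAtOne_coboundaryMatrix]
    refine Matrix.ext fun c b => ?_
    change Matrix.toLin' _ (Pi.single c 1) b = _
    rw [Matrix.toLin'_apply, Matrix.mulVec_single_one, Matrix.col_apply]
    rfl
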